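/- Let $a,b>0$, $\Omega=(0,a)\times(0,b)\subset\mathbb R^2$, and let $\varphi_1,\dots,\varphi_M>0$ and $\sigma>0$. Let $$X=\{\theta=(\kappa,\xi_0^2,G):\ \kappa\in[0,1],\ \xi_0^2>0,\ G>0\}\subset\mathbb R^3 ,$$ and for $\theta\in X$ let $g_\theta(s)=1/G$ for $s\le\xi_0^2$ and $g_\theta(s)=\frac1G\,(s/\xi_0^2)^{(1-\kappa)/2}$ for $s>\xi_0^2$ (the Ramberg–Osgood plasticity function). A weak solution of $$-\nabla\cdot\big(g_\theta(|\nabla u|^2)\nabla u\big)=2\varphi\ \text{ in }\Omega,\qquad u=0\ \text{ on }\partial\Omega,$$ is a function $u\in H^1_0(\Omega)$ such that for every $v\in H^1_0(\Omega)$ the function $g_\theta(|\nabla u|^2)\nabla u\cdot\nabla v$ is integrable on $\Omega$ and $\int_\Omega g_\theta(|\nabla u|^2)\nabla u\cdot\nabla v\,dx\,dy=2\varphi\int_\Omega v\,dx\,dy$. Let $\mu_0$ be any Borel probability measure on $X$ (the prior). Then the Bayesian inverse problem of recovering $\theta$ from $d=\mathbb F(\theta)+\varepsilon$, with $\varepsilon\sim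 N(0,\sigma^2 I)$ independent of $\theta\sim\mu_0$, is well-defined and well-posed in the following sense. 1. For every $\theta\in X$ and every $i$ there is exactly one weak solution $u(\cdot\,;\theta,\varphi_i)$ with $\varphi=\varphi_i$; hence the torque observation operator $\mathbb F:X\to\mathbb R^M$, $\mathbb F(\theta)_i=2\int_\Omega u(x,y;\theta,\varphi_i)\,dx\,dy$, is well-defined. 2. For every $y\in\mathbb R^M$ the constant $Z(y)=\int_X\exp\big(-\tfrac1{2\sigma^2}\|y-\mathbb F(\theta)\|^2\big)\,d\mu_0(\theta)$ satisfies $0<Z(y)<\infty$. 3. The measures $\mu^y$ given by $$\frac{d\mu^y}{d\mu_0}(\theta)=\frac1{Z(y)}\exp\Big(-\frac1{2\sigma^2}\|y-\mathbb F(\theta)\|^2\Big)$$ form a Markov kernel $y\mapsto\mu^y$ from $\mathbb R^M$ to $X$. Whenever $\theta$ and $\varepsilon$ are independent random variables on a probability space with laws $\mu_0$ and $N(0,\sigma^2I)$, $d=\mathbb F(\theta)+\varepsilon$ is a random variable and $y\mapsto\mu^y$ is a regular conditional distribution of $\theta$ given $d$ (the posterior); any other Markov kernel that is a regular conditional distribution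 of $\theta$ given $d$ agrees with it for almost every $y$ with respect to the law of $d$. 4. The posterior depends continuously on the data: for every $r>0$ there is a constant $L$ such that for all $y,y'\in\mathbb R^M$ with $\|y\|,\|y'\|\le r$, $$d_{\mathrm{Hell}}(\mu^{y},\mu^{y'})\le L\,\|y-y'\| ,$$ where $d_{\mathrm{Hell}}(\mu,\nu)^2=\frac12\int\big(\sqrt{d\mu/d\lambda}-\sqrt{d\nu/d\lambda}\big)^2d\lambda$ with $\lambda=\mu+\nu$ (the value is the same for every $\sigma$-finite measure $\lambda$ dominating $\mu$ and $\nu$). -/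

import Mathlib

open MeasureTheory ProbabilityTheory
open scoped ENNReal ContDiff

noncomputable section

namespace Torsion

/-- The plane with its Euclidean norm. -/
abbrev Plane : Type := EuclideanSpace ℝ (Fin 2)

/-- The cross section `Ω = (0,a) × (0,b)`. -/
def rect (a b : ℝ) : Set Plane :=
  {x | x 0 ∈ Set.Ioo 0 a ∧ x 1 ∈ Set.Ioo 0 b}

/-- Pairs `w = (u, p)` with `u ∈ L²(Ω)` and `p ∈ L²(Ω; ℝ²)`. A Sobolev function `u` is
represented by the pair `(u, ∇u)`. -/
abbrev L2Pair (a b : ℝ) : Type :=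
  Lp ℝ 2 (volume.restrict (rect a b)) × Lp Plane 2 (volume.restrict (rect a b))

/-- Test functions: smooth with compact support contained in `Ω`. -/
def IsTest (a b : ℝ) (ψ : Plane → ℝ) : Prop :=
  ContDiff ℝ ∞ ψ ∧ HasCompactSupport ψ ∧ tsupport ψ ⊆ rect a b

/-- `H¹(Ω)`: the pairs `(u, p)` such that `p` is the weak gradient of `u`. -/
def H1 (a b : ℝ) : Set (L2Pair a b) :=
  {w | ∀ ψ : Plane → ℝ, IsTest a b ψ → ∀ e : Plane,
    ∫ x in rect a b, w.1 x * inner ℝ (gradient ψ x) e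
      = - ∫ x in rect a b, inner ℝ (w.2 x) e * ψ x}

/-- The pairs `(ψ, ∇ψ)` with `ψ` a test function. -/
def testPairs (a b : ℝ) : Set (L2Pair a b) :=
  {w | ∃ ψ : Plane → ℝ, IsTest a b ψ ∧
    (w.1 : Plane → ℝ) =ᵐ[volume.restrict (rect a b)] ψ ∧
    (w.2 : Plane → Plane) =ᵐ[volume.restrict (rect a b)] gradient ψ}

/-- `H¹₀(Ω)`: the closure of the test functions in `H¹(Ω)`. The topology of
`L²(Ω) × L²(Ω; ℝ²)` on pairs `(u, ∇u)` is that of the `H¹` norm. -/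
def H10 (a b : ℝ) : Set (L2Pair a b) :=
  H1 a b ∩ closure (testPairs a b)

/-- Admissible parameters `θ = (κ, ξ₀², G)`: `κ ∈ [0,1]`, `ξ₀² > 0`, `G > 0`. -/
def paramSet : Set (ℝ × ℝ × ℝ) :=
  {θ | θ.1 ∈ Set.Icc 0 1 ∧ 0 < θ.2.1 ∧ 0 < θ.2.2}

/-- The parameter space `X`. -/
abbrev Param : Type := paramSet

/-- The Ramberg–Osgood plasticity function `s ↦ g(s)` of the variable `s = ξ²`. -/
def plasticity (θ : Param) (s : ℝ) : ℝ :=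
  if s ≤ θ.1.2.1 then 1 / θ.1.2.2
  else 1 / θ.1.2.2 * (s / θ.1.2.1) ^ ((1 - θ.1.1) / 2)

/-- `w = (u, ∇u)` is a weak solution of `-∇·(g(|∇u|²)∇u) = 2φ` in `Ω`, `u = 0` on `∂Ω`:
`u ∈ H¹₀(Ω)` and for all `v ∈ H¹₀(Ω)` the integral on the left exists and
`∫ g(|∇u|²) ∇u·∇v = 2φ ∫ v`. -/
def IsWeakSolution (a b : ℝ) (θ : Param) (φ : ℝ) (w : L2Pair a b) : Prop :=
  w ∈ H10 a b ∧ ∀ v ∈ H10 a b,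
    IntegrableOn (fun x => plasticity θ (‖w.2 x‖ ^ 2) * inner ℝ (w.2 x) (v.2 x)) (rect a b) ∧
    ∫ x in rect a b, plasticity θ (‖w.2 x‖ ^ 2) * inner ℝ (w.2 x) (v.2 x)
      = 2 * φ * ∫ x in rect a b, v.1 x

/-- The solution of the direct problem (meaningful as there is exactly one). -/
def solution (a b : ℝ) (θ : Param) (φ : ℝ) : L2Pair a b :=
  Classical.epsilon (IsWeakSolution a b θ φ)

/-- The data space `ℝ^M`. -/
abbrev Data (M : ℕ) : Type := EuclideanSpace ℝ (Fin M)

/-- The observation operator: the torques `2 ∫_Ω u(x; φᵢ) dx` at the angles `φᵢ`. -/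
def observe (a b : ℝ) {M : ℕ} (φ : Fin M → ℝ) (θ : Param) : Data M :=
  WithLp.toLp 2 fun i => 2 * ∫ x in rect a b, (solution a b θ (φ i)).1 x

/-- The (unnormalized) likelihood `exp(-½ ‖C^{-1/2}(y - F(θ))‖²)` for `C = σ² I`. -/
def likelihood {M : ℕ} (F : Param → Data M) (σ : ℝ) (y : Data M) (θ : Param) : ℝ :=
  Real.exp (-(1 / 2) * ‖σ⁻¹ • (y - F θ)‖ ^ 2)

/-- The normalizing constant `Z(y) = ∫ exp(-½ ‖C^{-1/2}(y - F(θ))‖²) dμ₀(θ)`. -/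
def evidence {M : ℕ} (F : Param → Data M) (σ : ℝ) (μ₀ : Measure Param) (y : Data M) : ℝ≥0∞ :=
  ∫⁻ θ, ENNReal.ofReal (likelihood F σ y θ) ∂μ₀

/-- The measure given by Bayes' rule: density `Z(y)⁻¹ exp(-½ ‖C^{-1/2}(y - F(θ))‖²)` with
respect to the prior `μ₀`. -/
def bayesMeasure {M : ℕ} (F : Param → Data M) (σ : ℝ) (μ₀ : Measure Param) (y : Data M) :
    Measure Param :=
  (evidence F σ μ₀ y)⁻¹ • μ₀.withDensity fun θ => ENNReal.ofReal (likelihood F σ y θ)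

/-- `K` is a (regular) conditional distribution of `X` given `Y` under `P`. -/
def IsConditionalLaw {S A B : Type*} [MeasurableSpace S] [MeasurableSpace A] [MeasurableSpace B]
    (P : Measure S) (X : S → A) (Y : S → B) (K : Kernel B A) : Prop :=
  P.map (fun s => (Y s, X s)) = (P.map Y) ⊗ₘ K

/-- Hellinger distance, `d(μ,ν)² = ½ ∫ (√(dμ/dλ) - √(dν/dλ))² dλ` with `λ = μ + ν`. -/
def hellingerDist {A : Type*} [MeasurableSpace A] (μ ν : Measure A) : ℝ :=
  Real.sqrt (1 / 2 * ∫ x, (Real.sqrt (μ.rnDeriv (μ + ν) x).toReal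
    - Real.sqrt (ν.rnDeriv (μ + ν) x).toReal) ^ 2 ∂(μ + ν))

end Torsion

end

/-! The analytic core is the existence of a weak solution with bounded gradient. The flux `g(|p|²)
p` grows like `|p|^(2-κ)`, so for `κ < 1` the flux of a general `H¹₀` function need not be square
integrable, and the Hilbert space theory of monotone operators does not apply directly. Instead the
convex energy is minimized among `K`-Lipschitz functions vanishing outside the rectangle
(`exists_energy_minimizer`). Uniform convexity makes minimizing sequences Cauchy, and the minimizer
satisfies a variational inequality.

The constraint is then shown to be inactive for large `K`
(`lipschitzWith_of_variational_inequality`). Quadratic barriers in one coordinate bound the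
minimizer near the boundary by `L` times the distance moved from outside, and comparison of `u` with
its translates carries this bound into the interior; `L` does not depend on `K`. For `K = L + 1`
small multiples of test functions are therefore admissible variations, and the Euler–Lagrange
equation follows. Since the flux is bounded, the equation extends by density to all test functions
in `H¹₀`.

The flux is strongly monotone with constant `1/G`. The difference of two weak solutions is an
admissible test function because integrability is part of the definition; testing with it gives
uniqueness. For two parameters the same estimate bounds the difference of solutions by the
difference of the two fluxes at one fixed bounded gradient, so the solution, and with it the
observation operator, is continuous in `θ` and hence measurable (`continuous_observe`).

The rest holds for every measurable forward map. By translation invariance and Tonelli the pair of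
data and parameter has a density with respect to Lebesgue measure times `μ₀`, and its disintegration
is Bayes' rule. The square root of the likelihood is Lipschitz in the data and the evidence is
bounded below on balls, which gives the Hellinger estimate. -/

noncomputable section

namespace Torsion

open Filter Topology Set
open scoped NNReal Convolution

/-! ### Almost everywhere calculus for Lipschitz functions -/

section LipschitzGradient

variable {f g : Plane → ℝ} {K C : ℝ≥0}

theorem norm_gradient_le_of_lipschitz (hf : LipschitzWith K f) (x : Plane) :
    ‖gradient f x‖ ≤ K := by
  rw [gradient, LinearIsometryEquiv.norm_map]
  exact norm_fderiv_le_of_lipschitz ℝ hf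

theorem measurable_gradient (f : Plane → ℝ) : Measurable (gradient f) :=
  (InnerProductSpace.toDual ℝ Plane).symm.continuous.measurable.comp (measurable_fderiv ℝ f)

theorem ae_hasGradientAt (hf : LipschitzWith K f) :
    ∀ᵐ x, HasGradientAt f (gradient f x) x := by
  filter_upwards [hf.ae_differentiableAt (μ := volume)] with x hx using hx.hasGradientAt

/-- Almost everywhere on the zero set of a Lipschitz function, every function dominated by it has
zero gradient. -/
theorem ae_hasGradientAt_zero_of_abs_le (hf : LipschitzWith K f) :
    ∀ᵐ x, f x = 0 → ∀ h : Plane → ℝ, (∀ y, |h y| ≤ |f y|) → HasGradientAt h 0 x := by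
  -- At a zero of `f` the function `|f|` has a minimum, so its gradient vanishes wherever it exists.
  -- Then `|f y| = o(|y - x|)`, and every dominated `h` inherits this. The exceptional null set
  -- depends on `f` only.
  have habs : LipschitzWith K (fun x => |f x|) := by
    simpa [Function.comp_def] using (LipschitzWith.comp lipschitzWith_one_norm hf)
  filter_upwards [ae_hasGradientAt habs] with x hx h0 h hh
  have hmin : IsLocalMin (fun x => |f x|) x := by
    refine Filter.Eventually.of_forall fun y => ?_
    simp [h0]
  have hz : gradient (fun x => |f x|) x = 0 := by
    rw [gradient, hmin.fderiv_eq_zero, map_zero]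
  rw [hz, hasGradientAt_iff_isLittleO] at hx
  rw [hasGradientAt_iff_isLittleO]
  have hh0 : h x = 0 := by simpa [h0] using hh x
  refine Asymptotics.IsBigO.trans_isLittleO (Asymptotics.IsBigO.of_bound 1 ?_) hx
  refine Filter.Eventually.of_forall fun y => ?_
  simpa [h0, hh0] using hh y

theorem ae_gradient_eq_zero (hf : LipschitzWith K f) :
    ∀ᵐ x, f x = 0 → gradient f x = 0 := by
  filter_upwards [ae_hasGradientAt_zero_of_abs_le hf] with x hx h0
  exact (hx h0 f fun y => le_rfl).gradient

theorem lipschitzWith_posPart (hf : LipschitzWith K f) :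
    LipschitzWith K (fun x => max (f x) 0) := hf.max_const 0

theorem ae_gradient_posPart (hf : LipschitzWith K f) :
    ∀ᵐ x, gradient (fun x => max (f x) 0) x = {x | 0 < f x}.indicator (gradient f) x := by
  filter_upwards [ae_hasGradientAt_zero_of_abs_le hf] with x hx
  rcases lt_trichotomy (f x) 0 with h | h | h
  · have : (fun x => max (f x) 0) =ᶠ[𝓝 x] fun _ => 0 := by
      filter_upwards [hf.continuous.continuousAt.eventually_lt_const h] with y hy
      exact max_eq_right hy.le
    rw [this.gradient_eq, gradient_fun_const]
    simp [h.not_gt]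
  · rw [(hx h (fun x => max (f x) 0) fun y => ?_).gradient]
    · simp [h]
    · rw [abs_of_nonneg (le_max_right _ _)]
      exact max_le (le_abs_self _) (abs_nonneg _)
  · have : (fun x => max (f x) 0) =ᶠ[𝓝 x] f := by
      filter_upwards [hf.continuous.continuousAt.eventually_const_lt h] with y hy
      exact max_eq_left hy.le
    rw [this.gradient_eq]
    simp [h]

theorem gradient_const_mul (t : ℝ) (f : Plane → ℝ) (x : Plane) :
    gradient (fun x => t * f x) x = t • gradient f x := by
  have h : fderiv ℝ (fun x => t * f x) x = t • fderiv ℝ f x :=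
    congrFun (fderiv_const_smul_field (𝕜 := ℝ) (f := f) t) x
  simp only [gradient, h, map_smulₛₗ, conj_trivial]

theorem ae_gradient_sub (hf : LipschitzWith K f) (hg : LipschitzWith C g) :
    ∀ᵐ x, gradient (fun x => f x - g x) x = gradient f x - gradient g x := by
  filter_upwards [hf.ae_differentiableAt (μ := volume), hg.ae_differentiableAt (μ := volume)]
    with x hx hy
  simp only [gradient]
  rw [fderiv_fun_sub hx hy, map_sub]

theorem gradient_add_const (f : Plane → ℝ) (t : ℝ) :
    gradient (fun x => f x + t) = gradient f := by
  ext1 x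
  simp only [gradient, fderiv_add_const]

theorem gradient_comp_add_right (f : Plane → ℝ) (h x : Plane) :
    gradient (fun x => f (x + h)) x = gradient f (x + h) := by
  simp only [gradient, fderiv_comp_add_right]

theorem lipschitzWith_comp_add_right (hf : LipschitzWith K f) (h : Plane) :
    LipschitzWith K (fun x => f (x + h)) := by
  refine LipschitzWith.of_dist_le_mul fun x y => ?_
  simpa using hf.dist_le_mul (x + h) (y + h)

theorem ae_lineDeriv_eq_inner_gradient (hf : LipschitzWith K f) (e : Plane) :
    ∀ᵐ x, lineDeriv ℝ f x e = inner ℝ (gradient f x) e := by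
  filter_upwards [hf.ae_differentiableAt (μ := volume)] with x hx
  rw [hx.lineDeriv_eq_fderiv, inner_gradient_left]

/-- Integration by parts for Lipschitz functions, one of them with compact support. -/
theorem integral_inner_gradient_mul (hf : LipschitzWith K f) (hg : LipschitzWith C g)
    (hgc : HasCompactSupport g) (e : Plane) :
    ∫ x, inner ℝ (gradient f x) e * g x = - ∫ x, f x * inner ℝ (gradient g x) e := by
  have h := LipschitzWith.integral_lineDeriv_mul_eq (μ := volume) hf hg hgc e
  rw [integral_congr_ae (g := fun x => lineDeriv ℝ f x e * g x), h, ← integral_neg]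
  · refine integral_congr_ae ?_
    filter_upwards [ae_lineDeriv_eq_inner_gradient hg (-e)] with x hx
    rw [hx, inner_neg_right]
    ring
  · filter_upwards [ae_lineDeriv_eq_inner_gradient hf e] with x hx
    rw [hx]

/-- Pairing with each vector `e` reduces this to the scalar formula. The vector form identifies
almost everywhere limits of gradients in `VanishingLip.exists_limit`. -/
theorem integral_smul_gradient (hf : LipschitzWith K f) (hg : LipschitzWith C g)
    (hgc : HasCompactSupport g) :
    ∫ x, g x • gradient f x = - ∫ x, f x • gradient g x := by
  have hcont := hf.continuous
  have h1 : Integrable fun x => g x • gradient f x :=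
    (hg.continuous.integrable_of_hasCompactSupport hgc).smul_of_top_left
      (memLp_top_of_bound (measurable_gradient f).aestronglyMeasurable K
        (.of_forall fun x => norm_gradient_le_of_lipschitz hf x))
  have hgg : HasCompactSupport (gradient g) := by
    refine (hgc.fderiv ℝ).comp_left (g := (InnerProductSpace.toDual ℝ Plane).symm) (map_zero _)
  have h2 : Integrable fun x => f x • gradient g x := by
    refine (integrableOn_iff_integrable_of_support_subset (s := tsupport (gradient g)) ?_).1 ?_
    · exact (Function.support_smul_subset_right f (gradient g)).trans (subset_tsupport _)
    · obtain ⟨B, hB⟩ := hgg.isCompact.exists_bound_of_continuousOn hcont.continuousOn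
      refine Measure.integrableOn_of_bounded (M := B * C) hgg.isCompact.measure_lt_top.ne
        (hcont.aestronglyMeasurable.smul (measurable_gradient g).aestronglyMeasurable) ?_
      filter_upwards [ae_restrict_mem hgg.isCompact.isClosed.measurableSet] with x hx
      rw [norm_smul]
      exact mul_le_mul (hB x hx) (norm_gradient_le_of_lipschitz hg x) (norm_nonneg _)
        ((norm_nonneg _).trans (hB x hx))
  refine ext_inner_left ℝ fun e => ?_
  rw [inner_neg_right, ← integral_inner h1, ← integral_inner h2]
  have h := integral_inner_gradient_mul hf hg hgc e
  simp only [real_inner_comm e] at h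
  simp only [inner_smul_right, ← h, mul_comm]

end LipschitzGradient

/-! ### The rectangle, Lipschitz functions vanishing outside it, and Poincaré's inequality -/

section Rect

variable {a b : ℝ}

theorem isOpen_rect (a b : ℝ) : IsOpen (rect a b) := by
  have h0 : Continuous fun x : Plane => x 0 := by fun_prop
  have h1 : Continuous fun x : Plane => x 1 := by fun_prop
  exact (isOpen_Ioo.preimage h0).inter (isOpen_Ioo.preimage h1)

theorem measurableSet_rect (a b : ℝ) : MeasurableSet (rect a b) := (isOpen_rect a b).measurableSet

theorem abs_apply_le_norm (x : Plane) (i : Fin 2) : |x i| ≤ ‖x‖ :=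
  PiLp.norm_apply_le x i

theorem rect_subset_closedBall (a b : ℝ) : rect a b ⊆ Metric.closedBall 0 (|a| + |b|) := by
  intro x hx
  obtain ⟨⟨h0, h0'⟩, h1, h1'⟩ := hx
  rw [mem_closedBall_zero_iff, EuclideanSpace.norm_eq, Fin.sum_univ_two]
  refine Real.sqrt_le_iff.2 ⟨by positivity, ?_⟩
  simp only [Real.norm_eq_abs, abs_of_pos h0, abs_of_pos h1]
  have ha := h0'.le.trans (le_abs_self a)
  have hb := h1'.le.trans (le_abs_self b)
  nlinarith

theorem volume_rect_lt_top (a b : ℝ) : volume (rect a b) < ⊤ :=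
  (measure_mono (rect_subset_closedBall a b)).trans_lt measure_closedBall_lt_top

instance isFiniteMeasure_restrict_rect : IsFiniteMeasure (volume.restrict (rect a b)) :=
  ⟨by simpa using volume_rect_lt_top a b⟩

theorem hasCompactSupport_of_eq_zero {E : Type*} [Zero E] {f : Plane → E}
    (hf : ∀ x ∉ rect a b, f x = 0) : HasCompactSupport f :=
  HasCompactSupport.intro (isCompact_closedBall 0 (|a| + |b|)) fun x hx =>
    hf x fun h => hx (rect_subset_closedBall a b h)

theorem integrable_of_bound_of_eq_zero {E : Type*} [NormedAddCommGroup E] {f : Plane → E}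
    (hf : AEStronglyMeasurable f) (C : ℝ) (hC : ∀ᵐ x, ‖f x‖ ≤ C)
    (h0 : ∀ᵐ x, x ∉ rect a b → f x = 0) : Integrable f := by
  have : IntegrableOn f (rect a b) :=
    Integrable.of_bound hf.restrict C (ae_restrict_of_ae hC)
  exact this.integrable_of_ae_notMem_eq_zero h0

/-- Dominated convergence with a constant bound on the rectangle. Integrals are kept over the whole
plane so that they can later be translated freely. -/
theorem tendsto_integral_of_bound_of_eq_zero {E : Type*} [NormedAddCommGroup E] [NormedSpace ℝ E]
    {F : ℕ → Plane → E} {f : Plane → E} (hF : ∀ n, AEStronglyMeasurable (F n)) (C : ℝ)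
    (hC : ∀ n, ∀ᵐ x, ‖F n x‖ ≤ C) (h0 : ∀ n, ∀ᵐ x, x ∉ rect a b → F n x = 0)
    (hlim : ∀ᵐ x, Tendsto (fun n => F n x) atTop (𝓝 (f x))) :
    Tendsto (fun n => ∫ x, F n x) atTop (𝓝 (∫ x, f x)) := by
  refine tendsto_integral_of_dominated_convergence ((rect a b).indicator fun _ => C) hF ?_
    (fun n => ?_) hlim
  · exact (integrable_indicator_iff (measurableSet_rect a b)).2
      (integrableOn_const (volume_rect_lt_top a b).ne)
  · filter_upwards [hC n, h0 n] with x h1 h2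
    by_cases hx : x ∈ rect a b
    · simpa [hx] using h1
    · simp [hx, h2 hx]

/-- Integration by parts against the coordinate `x i`, whose gradient is the unit vector. It gives
Poincaré's inequality with `z = f²`, and it produces the load term of the barrier. -/
theorem integral_coord_mul_inner_gradient (i : Fin 2) {K : ℝ≥0} {z : Plane → ℝ}
    (hz : LipschitzWith K z) (hzc : HasCompactSupport z) :
    ∫ x : Plane, x i * inner ℝ (gradient z x) (EuclideanSpace.single i 1) = - ∫ x, z x := by
  have hπ : LipschitzWith 1 fun x : Plane => x i := by
    refine LipschitzWith.of_dist_le_mul fun x y => ?_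
    have := abs_apply_le_norm (x - y) i
    simpa [Real.dist_eq, dist_eq_norm] using this
  have hgπ : ∀ x : Plane, inner ℝ (gradient (fun x : Plane => x i) x)
      (EuclideanSpace.single i 1) = 1 := by
    intro x
    rw [inner_gradient_left]
    have : HasFDerivAt (fun x : Plane => x i) (EuclideanSpace.proj i : Plane →L[ℝ] ℝ) x :=
      (EuclideanSpace.proj (𝕜 := ℝ) (i : Fin 2)).hasFDerivAt
    rw [this.fderiv]
    simp
  have key := integral_inner_gradient_mul hπ hz hzc (EuclideanSpace.single i 1)
  simp only [hgπ, one_mul] at key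
  rw [key, neg_neg]

/-- `K`-Lipschitz functions on the plane that vanish outside `(0,a) × (0,b)`. -/
structure VanishingLip (a b : ℝ) (K : ℝ≥0) (f : Plane → ℝ) : Prop where
  lip : LipschitzWith K f
  zero : ∀ x ∉ rect a b, f x = 0

namespace VanishingLip

variable {f g : Plane → ℝ} {K : ℝ≥0}

theorem hasCompactSupport (hf : VanishingLip a b K f) : HasCompactSupport f :=
  hasCompactSupport_of_eq_zero hf.zero

theorem gradient_ae_zero (hf : VanishingLip a b K f) :
    ∀ᵐ x, x ∉ rect a b → gradient f x = 0 := by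
  filter_upwards [ae_gradient_eq_zero hf.lip] with x hx h using hx (hf.zero x h)

theorem abs_le (hf : VanishingLip a b K f) (x : Plane) : |f x| ≤ K * (|a| + |b|) := by
  by_cases hx : x ∈ rect a b
  · have h0 : f 0 = 0 := hf.zero 0 fun h => by simpa using h.1.1
    have h1 := hf.lip.dist_le_mul x 0
    have h2 := mem_closedBall_zero_iff.1 (rect_subset_closedBall a b hx)
    rw [h0, Real.dist_eq, sub_zero, dist_zero_right] at h1
    exact h1.trans (by gcongr)
  · rw [hf.zero x hx, abs_zero]
    positivity

theorem integrable (hf : VanishingLip a b K f) : Integrable f :=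
  hf.lip.continuous.integrable_of_hasCompactSupport hf.hasCompactSupport

theorem integrable_sq (hf : VanishingLip a b K f) : Integrable fun x => f x ^ 2 :=
  (hf.lip.continuous.pow 2).integrable_of_hasCompactSupport
    (hasCompactSupport_of_eq_zero (a := a) (b := b) fun x hx => by simp [hf.zero x hx])

theorem integrable_norm_gradient_sq (hf : VanishingLip a b K f) :
    Integrable fun x => ‖gradient f x‖ ^ 2 := by
  refine integrable_of_bound_of_eq_zero (a := a) (b := b)
    ((measurable_gradient f).norm.pow_const 2).aestronglyMeasurable (K ^ 2 : ℝ) ?_ ?_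
  · filter_upwards with x
    have := norm_gradient_le_of_lipschitz hf.lip x
    rw [Real.norm_eq_abs, abs_of_nonneg (by positivity)]
    gcongr
  · filter_upwards [hf.gradient_ae_zero] with x hx h
    simp [hx h]

theorem posPart_sub {P Q : Plane → ℝ} {C : ℝ≥0} (hP : LipschitzWith K P) (hQ : LipschitzWith C Q)
    (h : ∀ x ∉ rect a b, P x ≤ Q x) :
    VanishingLip a b (K + C) fun x => max (P x - Q x) 0 :=
  ⟨lipschitzWith_posPart (hP.sub hQ), fun x hx => max_eq_right (sub_nonpos.2 (h x hx))⟩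

/-- The Poincaré inequality. -/
theorem integral_sq_le (hf : VanishingLip a b K f) :
    ∫ x, f x ^ 2 ≤ 4 * a ^ 2 * ∫ x, ‖gradient f x‖ ^ 2 := by
  obtain ⟨B, hB0, hB⟩ : ∃ B : ℝ, 0 ≤ B ∧ ∀ x, |f x| ≤ B :=
    ⟨K * (|a| + |b|), by positivity, hf.abs_le⟩
  have hsq : LipschitzWith (2 * B.toNNReal * K) fun x => f x ^ 2 := by
    refine LipschitzWith.of_dist_le_mul fun x y => ?_
    have h1 := hf.lip.dist_le_mul x y
    rw [Real.dist_eq] at h1 ⊢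
    have h2 : |f x + f y| ≤ 2 * B := (abs_add_le _ _).trans (by linarith [hB x, hB y])
    have : f x ^ 2 - f y ^ 2 = (f x + f y) * (f x - f y) := by ring
    rw [this, abs_mul]
    push_cast
    rw [Real.coe_toNNReal _ hB0, mul_assoc (2 * B)]
    gcongr
  have hsqc : HasCompactSupport fun x => f x ^ 2 :=
    hasCompactSupport_of_eq_zero (a := a) (b := b) fun x hx => by simp [hf.zero x hx]
  -- `∫ f² = -∫ 2 x₀ f ∂₀f`, and Young's inequality with `0 < x₀ < a` bounds the integrand by `f²/2
  -- + 2a²|∇f|²`. Absorbing `∫ f²/2` on the left gives the constant `4a²`.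
  have key := integral_coord_mul_inner_gradient 0 hsq hsqc
  rw [eq_comm, neg_eq_iff_eq_neg, ← integral_neg] at key
  have hle : ∀ᵐ x, -(x 0 * inner ℝ (gradient (fun x => f x ^ 2) x) (EuclideanSpace.single 0 1)) ≤
      1 / 2 * f x ^ 2 + 2 * a ^ 2 * ‖gradient f x‖ ^ 2 := by
    filter_upwards [ae_hasGradientAt hf.lip] with x hx
    by_cases hxr : x ∈ rect a b
    · have hd : gradient (fun x => f x ^ 2) x = (2 * f x) • gradient f x := by
        have h1 := hx.differentiableAt
        simp only [gradient]
        rw [fderiv_fun_pow 2 h1]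
        simp
      rw [hd, inner_smul_left]
      have h1 : |inner ℝ (gradient f x) (EuclideanSpace.single 0 1 : Plane)| ≤ ‖gradient f x‖ := by
        simpa using abs_real_inner_le_norm (gradient f x) (EuclideanSpace.single 0 1 : Plane)
      set q : ℝ := inner ℝ (gradient f x) (EuclideanSpace.single 0 1 : Plane)
      have h2 : q ^ 2 ≤ ‖gradient f x‖ ^ 2 := sq_le_sq.2 (by simpa using h1)
      obtain ⟨⟨h0, h0'⟩, -⟩ := hxr
      have h3 : x 0 ^ 2 * q ^ 2 ≤ a ^ 2 * ‖gradient f x‖ ^ 2 := by gcongr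
      simp only [conj_trivial]
      nlinarith [sq_nonneg (f x + 2 * (x 0 * q))]
    · have h0 : f x = 0 := hf.zero x hxr
      have hd : gradient (fun x => f x ^ 2) x = 0 := by
        simp only [gradient]
        rw [fderiv_fun_pow 2 hx.differentiableAt]
        simp [h0]
      rw [hd]
      simp
      positivity
  have hInt : Integrable fun x => 1 / 2 * f x ^ 2 + 2 * a ^ 2 * ‖gradient f x‖ ^ 2 :=
    (hf.integrable_sq.const_mul _).add (hf.integrable_norm_gradient_sq.const_mul _)
  -- Integrability need not be proved: failing it, the integral is `0` by convention, hence `∫ f² =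
  -- 0` and the claim is trivial.
  by_cases hI : Integrable fun x : Plane =>
      -(x 0 * inner ℝ (gradient (fun x => f x ^ 2) x) (EuclideanSpace.single 0 1))
  · have hmono := integral_mono_ae hI hInt hle
    rw [← key, integral_add (hf.integrable_sq.const_mul _)
      (hf.integrable_norm_gradient_sq.const_mul _), integral_const_mul, integral_const_mul] at hmono
    linarith
  · rw [key, integral_undef hI]
    have : 0 ≤ ∫ x, ‖gradient f x‖ ^ 2 := integral_nonneg fun x => by positivity
    positivity

theorem eq_zero_of_gradient_ae_zero (hf : VanishingLip a b K f)
    (h : ∀ᵐ x, gradient f x = 0) (x : Plane) : f x = 0 := by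
  have h1 : ∫ x, ‖gradient f x‖ ^ 2 = 0 :=
    integral_eq_zero_of_ae (by filter_upwards [h] with x hx using by simp [hx])
  have h2 : ∫ x, f x ^ 2 = 0 := by
    refine le_antisymm ?_ (integral_nonneg fun x => sq_nonneg _)
    simpa [h1] using hf.integral_sq_le
  rw [integral_eq_zero_iff_of_nonneg (fun x => sq_nonneg _) hf.integrable_sq] at h2
  have h3 := (Continuous.ae_eq_iff_eq volume (hf.lip.continuous.pow 2) continuous_const).1 h2
  have h4 : f x ^ 2 = 0 := congrFun h3 x
  exact pow_eq_zero_iff two_ne_zero |>.1 h4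

end VanishingLip

end Rect

/-! ### Convexity of the energy density and monotonicity of the flux -/

/-- Continuous nondecreasing stiffness functions bounded below by `c > 0`. -/
structure IsStiffness (g : ℝ → ℝ) (c : ℝ) : Prop where
  pos : 0 < c
  cont : Continuous g
  mono : Monotone g
  le : ∀ s, c ≤ g s

/-- The flux `g(|p|²) p`. -/
def flux (g : ℝ → ℝ) (p : Plane) : Plane := g (‖p‖ ^ 2) • p

/-- The energy density, a potential of the flux. -/
def energyDensity (g : ℝ → ℝ) (p : Plane) : ℝ := (∫ s in (0 : ℝ)..‖p‖ ^ 2, g s) / 2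

@[simp] theorem flux_zero (g : ℝ → ℝ) : flux g 0 = 0 := by simp [flux]

@[simp] theorem energyDensity_zero (g : ℝ → ℝ) : energyDensity g 0 = 0 := by simp [energyDensity]

namespace IsStiffness

variable {g : ℝ → ℝ} {c : ℝ}

theorem nonneg (hg : IsStiffness g c) (s : ℝ) : 0 ≤ g s := hg.pos.le.trans (hg.le s)

theorem continuous_flux (hg : IsStiffness g c) : Continuous (flux g) :=
  (hg.cont.comp (continuous_norm.pow 2)).smul continuous_id

theorem continuous_energyDensity (hg : IsStiffness g c) : Continuous (energyDensity g) := by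
  have h : Continuous fun t => ∫ s in (0 : ℝ)..t, g s :=
    intervalIntegral.continuous_primitive (fun _ _ => hg.cont.intervalIntegrable _ _) 0
  exact (h.comp (continuous_norm.pow 2)).div_const 2

theorem norm_flux_le (hg : IsStiffness g c) {p : Plane} {K : ℝ} (hp : ‖p‖ ≤ K) :
    ‖flux g p‖ ≤ g (K ^ 2) * K := by
  rw [flux, norm_smul, Real.norm_eq_abs, abs_of_nonneg (hg.nonneg _)]
  have : g (‖p‖ ^ 2) ≤ g (K ^ 2) := hg.mono (by gcongr)
  have := hg.nonneg (K ^ 2)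
  gcongr

/-- A primitive of a nondecreasing function is convex; this is its tangent inequality at `s`, valid
on both sides of `s`. -/
theorem mul_sub_le_integral (hg : IsStiffness g c) (s t : ℝ) :
    g s * (t - s) ≤ ∫ x in s..t, g x := by
  rcases le_total s t with h | h
  · have := intervalIntegral.integral_mono_on (μ := volume) (f := fun _ => g s) h
      intervalIntegrable_const
      (hg.cont.intervalIntegrable s t) fun x hx => hg.mono hx.1
    simpa [mul_comm] using this
  · rw [intervalIntegral.integral_symm]
    have := intervalIntegral.integral_mono_on (μ := volume) (g := fun _ => g s) h
      (hg.cont.intervalIntegrable t s) intervalIntegrable_const fun x hx => hg.mono hx.2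
    simp only [intervalIntegral.integral_const, smul_eq_mul] at this
    linarith

/-- Strong convexity of the energy density. -/
theorem energyDensity_ge (hg : IsStiffness g c) (p q : Plane) :
    energyDensity g p + inner ℝ (flux g p) (q - p) + c / 2 * ‖q - p‖ ^ 2 ≤ energyDensity g q := by
  have h := hg.mul_sub_le_integral (‖p‖ ^ 2) (‖q‖ ^ 2)
  have hadd := intervalIntegral.integral_add_adjacent_intervals
    (hg.cont.intervalIntegrable (μ := volume) 0 (‖p‖ ^ 2))
    (hg.cont.intervalIntegrable (μ := volume) (‖p‖ ^ 2) (‖q‖ ^ 2))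
  -- In the tangent inequality between `‖p‖²` and `‖q‖²`, the mixed term of this expansion yields
  -- the flux, and the square term, multiplied by `g ≥ c`, yields the quadratic remainder.
  have hq : ‖q‖ ^ 2 = ‖p‖ ^ 2 + 2 * inner ℝ p (q - p) + ‖q - p‖ ^ 2 := by
    rw [← norm_add_sq_real]
    simp
  rw [flux, inner_smul_left]
  simp only [energyDensity, conj_trivial]
  rw [hq] at h hadd ⊢
  have hc := mul_le_mul_of_nonneg_right (hg.le (‖p‖ ^ 2)) (sq_nonneg ‖q - p‖)
  nlinarith

theorem energyDensity_nonneg (hg : IsStiffness g c) (p : Plane) : 0 ≤ energyDensity g p := by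
  have h := hg.energyDensity_ge 0 p
  have hc := hg.pos
  have : 0 ≤ c / 2 * ‖p‖ ^ 2 := by positivity
  simp only [energyDensity_zero, flux_zero, inner_zero_left, sub_zero] at h
  linarith

theorem energyDensity_le (hg : IsStiffness g c) {p : Plane} {K : ℝ} (hp : ‖p‖ ≤ K) :
    energyDensity g p ≤ g (K ^ 2) * K * K := by
  have h := hg.energyDensity_ge p 0
  have h1 := hg.pos
  have h2 : inner ℝ (flux g p) p ≤ ‖flux g p‖ * ‖p‖ := real_inner_le_norm _ _
  have h3 := mul_le_mul (hg.norm_flux_le hp) hp (norm_nonneg _)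
    ((norm_nonneg _).trans (hg.norm_flux_le hp))
  have h4 : 0 ≤ c / 2 * ‖p‖ ^ 2 := by positivity
  simp at h
  linarith

/-- Strong monotonicity of the flux. -/
theorem flux_monotone (hg : IsStiffness g c) (p q : Plane) :
    c * ‖p - q‖ ^ 2 ≤ inner ℝ (flux g p - flux g q) (p - q) := by
  have h1 := hg.energyDensity_ge p q
  have h2 := hg.energyDensity_ge q p
  rw [norm_sub_rev q p, ← neg_sub p q, inner_neg_right] at h1
  rw [inner_sub_left]
  linarith

/-- Strong convexity is expanded at the midpoint towards `p` and towards `q`; the linear terms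
cancel on averaging. -/
theorem energyDensity_midpoint (hg : IsStiffness g c) (p q : Plane) :
    energyDensity g ((1 / 2 : ℝ) • (p + q)) + c / 8 * ‖p - q‖ ^ 2 ≤
      (energyDensity g p + energyDensity g q) / 2 := by
  have h1 := hg.energyDensity_ge ((1 / 2 : ℝ) • (p + q)) p
  have h2 := hg.energyDensity_ge ((1 / 2 : ℝ) • (p + q)) q
  have e1 : p - (1 / 2 : ℝ) • (p + q) = (1 / 2 : ℝ) • (p - q) := by module
  have e2 : q - (1 / 2 : ℝ) • (p + q) = -((1 / 2 : ℝ) • (p - q)) := by module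
  rw [e1] at h1
  rw [e2, inner_neg_right, norm_neg] at h2
  rw [norm_smul, Real.norm_eq_abs, abs_of_pos (by norm_num : (0 : ℝ) < 1 / 2)] at h1 h2
  nlinarith

end IsStiffness

/-! ### Minimization of the energy under a Lipschitz constraint -/

/-- The total energy of a function `u` under the load `f`. -/
def energy (g : ℝ → ℝ) (f : ℝ) (u : Plane → ℝ) : ℝ :=
  ∫ x, (energyDensity g (gradient u x) - f * u x)

section Minimizer

variable {g : ℝ → ℝ} {c a b f : ℝ} {K : ℝ≥0} {u v : Plane → ℝ}

namespace VanishingLip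

/-- The constant `K` does not grow under convex combinations, so the constraint set of the
minimization is convex. -/
theorem add_mul_sub (hu : VanishingLip a b K u) (hv : VanishingLip a b K v) {t : ℝ}
    (ht0 : 0 ≤ t) (ht1 : t ≤ 1) : VanishingLip a b K fun x => u x + t * (v x - u x) := by
  refine ⟨LipschitzWith.of_dist_le_mul fun x y => ?_, fun x hx => ?_⟩
  · have h1 := hu.lip.dist_le_mul x y
    have h2 := hv.lip.dist_le_mul x y
    rw [Real.dist_eq] at h1 h2 ⊢
    have e : u x + t * (v x - u x) - (u y + t * (v y - u y))
        = (1 - t) * (u x - u y) + t * (v x - v y) := by ring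
    rw [e]
    refine (abs_add_le _ _).trans ?_
    rw [abs_mul, abs_mul, abs_of_nonneg ht0, abs_of_nonneg (sub_nonneg.2 ht1)]
    have := sub_nonneg.2 ht1
    nlinarith
  · simp [hu.zero x hx, hv.zero x hx]

theorem sub (hu : VanishingLip a b K u) (hv : VanishingLip a b K v) :
    VanishingLip a b (K + K) fun x => u x - v x :=
  ⟨hu.lip.sub hv.lip, fun x hx => by simp [hu.zero x hx, hv.zero x hx]⟩

theorem integrable_inner_gradient (hg : IsStiffness g c) {P : Plane → ℝ} {C : ℝ≥0}
    (hP : LipschitzWith C P) (hv : VanishingLip a b K v) :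
    Integrable fun x => inner ℝ (flux g (gradient P x)) (gradient v x) := by
  refine integrable_of_bound_of_eq_zero (a := a) (b := b) ?_ (g (C ^ 2) * C * K) ?_ ?_
  · exact ((hg.continuous_flux.measurable.comp (measurable_gradient P)).inner
      (measurable_gradient v)).aestronglyMeasurable
  · refine Eventually.of_forall fun x => (norm_inner_le_norm _ _).trans ?_
    have h1 := hg.norm_flux_le (norm_gradient_le_of_lipschitz hP x)
    exact mul_le_mul h1 (norm_gradient_le_of_lipschitz hv.lip x) (norm_nonneg _)
      ((norm_nonneg _).trans h1)
  · filter_upwards [hv.gradient_ae_zero] with x hx h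
    simp [hx h]

theorem integrable_energyDensity (hg : IsStiffness g c) (hu : VanishingLip a b K u) :
    Integrable fun x => energyDensity g (gradient u x) := by
  refine integrable_of_bound_of_eq_zero (a := a) (b := b)
    (hg.continuous_energyDensity.measurable.comp (measurable_gradient u)).aestronglyMeasurable
    (g (K ^ 2) * K * K) ?_ ?_
  · refine Eventually.of_forall fun x => ?_
    rw [Real.norm_eq_abs, abs_of_nonneg (hg.energyDensity_nonneg _)]
    exact hg.energyDensity_le (norm_gradient_le_of_lipschitz hu.lip x)
  · filter_upwards [hu.gradient_ae_zero] with x hx h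
    simp [hx h]

theorem energy_eq (hg : IsStiffness g c) (hu : VanishingLip a b K u) :
    energy g f u = (∫ x, energyDensity g (gradient u x)) - f * ∫ x, u x := by
  rw [energy, integral_sub (hu.integrable_energyDensity hg) (hu.integrable.const_mul _),
    integral_const_mul]

/-- Integrated midpoint convexity. Its gap term forces minimizing sequences to have Cauchy gradients
in `L²`. -/
theorem energy_midpoint (hg : IsStiffness g c) (hu : VanishingLip a b K u)
    (hv : VanishingLip a b K v) :
    energy g f (fun x => u x + 1 / 2 * (v x - u x)) +
      c / 8 * ∫ x, ‖gradient (fun x => u x - v x) x‖ ^ 2 ≤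
      (energy g f u + energy g f v) / 2 := by
  have hm := hu.add_mul_sub hv (t := 1 / 2) (by norm_num) (by norm_num)
  have hd := hu.sub hv
  rw [hm.energy_eq hg, hu.energy_eq hg, hv.energy_eq hg]
  have h1 : ∫ x, (u x + 1 / 2 * (v x - u x)) = ((∫ x, u x) + ∫ x, v x) / 2 := by
    rw [integral_add hu.integrable ((hv.sub hu).integrable.const_mul _),
      integral_const_mul, integral_sub hv.integrable hu.integrable]
    ring
  have h2 : ∫ x, (energyDensity g (gradient (fun x => u x + 1 / 2 * (v x - u x)) x) +
      c / 8 * ‖gradient (fun x => u x - v x) x‖ ^ 2) ≤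
      ∫ x, (energyDensity g (gradient u x) + energyDensity g (gradient v x)) / 2 := by
    refine integral_mono_ae ((hm.integrable_energyDensity hg).add
      (hd.integrable_norm_gradient_sq.const_mul _)) (((hu.integrable_energyDensity hg).add
      (hv.integrable_energyDensity hg)).div_const 2) ?_
    filter_upwards [hu.lip.ae_differentiableAt (μ := volume),
      hv.lip.ae_differentiableAt (μ := volume), ae_gradient_sub hu.lip hv.lip] with x hx hy h1
    have h2 : gradient (fun x => u x + 1 / 2 * (v x - u x)) x
        = (1 / 2 : ℝ) • (gradient u x + gradient v x) := by
      have e : (fun x => u x + 1 / 2 * (v x - u x)) = fun x => (1 / 2 : ℝ) * (u x + v x) := by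
        ext x; ring
      rw [e, gradient_const_mul]
      simp only [gradient]
      rw [fderiv_fun_add hx hy, map_add]
    simp only [h1, h2]
    exact hg.energyDensity_midpoint _ _
  rw [integral_add (hm.integrable_energyDensity hg) (hd.integrable_norm_gradient_sq.const_mul _),
    integral_const_mul, integral_div, integral_add (hu.integrable_energyDensity hg)
      (hv.integrable_energyDensity hg)] at h2
  rw [h1]
  linarith

end VanishingLip

end Minimizer

theorem norm_toLp_sq {α E : Type*} [MeasurableSpace α] {μ : Measure α} [NormedAddCommGroup E]
    [InnerProductSpace ℝ E] {F : α → E} (hF : MemLp F 2 μ) :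
    ‖hF.toLp F‖ ^ 2 = ∫ x, ‖F x‖ ^ 2 ∂μ := by
  rw [← real_inner_self_eq_norm_sq, L2.inner_def]
  refine integral_congr_ae ?_
  filter_upwards [hF.coeFn_toLp] with x hx
  rw [hx, real_inner_self_eq_norm_sq]

section Minimizer

variable {g : ℝ → ℝ} {c a b f : ℝ} {K : ℝ≥0} {u v : Plane → ℝ}

namespace VanishingLip

theorem memLp (hu : VanishingLip a b K u) : MemLp u 2 (volume.restrict (rect a b)) :=
  MemLp.of_bound hu.lip.continuous.aestronglyMeasurable _ (.of_forall hu.abs_le)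

theorem memLp_gradient (hu : VanishingLip a b K u) :
    MemLp (gradient u) 2 (volume.restrict (rect a b)) :=
  MemLp.of_bound (measurable_gradient u).aestronglyMeasurable _
    (.of_forall (norm_gradient_le_of_lipschitz hu.lip))

/-- The pair `(u, ∇u)` in `L²`. -/
def toPair (hu : VanishingLip a b K u) : L2Pair a b :=
  (hu.memLp.toLp u, hu.memLp_gradient.toLp (gradient u))

theorem norm_toPair_snd_sub_sq (hu : VanishingLip a b K u) (hv : VanishingLip a b K v) :
    ‖hu.toPair.2 - hv.toPair.2‖ ^ 2 = ∫ x, ‖gradient (fun x => u x - v x) x‖ ^ 2 := by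
  simp only [toPair]
  rw [← MemLp.toLp_sub, norm_toLp_sq, ← setIntegral_eq_integral_of_ae_compl_eq_zero
    (s := rect a b) (f := fun x => ‖gradient (fun x => u x - v x) x‖ ^ 2)]
  · refine integral_congr_ae (ae_restrict_of_ae ?_)
    filter_upwards [ae_gradient_sub hu.lip hv.lip] with x hx
    simp [hx]
  · filter_upwards [(hu.sub hv).gradient_ae_zero] with x hx h
    simp [hx h]

theorem norm_toPair_fst_sub_sq_le (hu : VanishingLip a b K u) (hv : VanishingLip a b K v) :
    ‖hu.toPair.1 - hv.toPair.1‖ ^ 2 ≤ 4 * a ^ 2 * ‖hu.toPair.2 - hv.toPair.2‖ ^ 2 := by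
  rw [norm_toPair_snd_sub_sq hu hv]
  refine le_trans (le_of_eq ?_) (hu.sub hv).integral_sq_le
  simp only [toPair]
  rw [← MemLp.toLp_sub, norm_toLp_sq, ← setIntegral_eq_integral_of_forall_compl_eq_zero
    (s := rect a b) (f := fun x => (u x - v x) ^ 2)]
  · simp
  · intro x hx
    simp [(hu.sub hv).zero x hx]

/-- Limits of vanishing Lipschitz functions with a.e. convergence of values and gradients. -/
theorem exists_limit {w : ℕ → Plane → ℝ} (hw : ∀ n, VanishingLip a b K (w n))
    {U : Plane → ℝ} {p : Plane → Plane}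
    (hU : ∀ᵐ x ∂volume.restrict (rect a b), Tendsto (fun n => w n x) atTop (𝓝 (U x)))
    (hp : ∀ᵐ x ∂volume.restrict (rect a b), Tendsto (fun n => gradient (w n) x) atTop (𝓝 (p x))) :
    ∃ u, VanishingLip a b K u ∧ (∀ᵐ x, Tendsto (fun n => w n x) atTop (𝓝 (u x))) ∧
      ∀ᵐ x, Tendsto (fun n => gradient (w n) x) atTop (𝓝 (gradient u x)) := by
  classical
  -- On the set `D` of convergence the pointwise limit is again `K`-Lipschitz. It is extended from
  -- `D` to the plane with the same constant; `D` contains the complement of the rectangle, so the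
  -- extension still vanishes there.
  let D : Set Plane := {x | ∃ l, Tendsto (fun n => w n x) atTop (𝓝 l)}
  have hD : ∀ x, ∃ l, x ∈ D → Tendsto (fun n => w n x) atTop (𝓝 l) := fun x => by
    by_cases hx : x ∈ D
    · exact ⟨hx.choose, fun _ => hx.choose_spec⟩
    · exact ⟨0, fun h => absurd h hx⟩
  choose u₀ hu₀ using hD
  have hlip : LipschitzOnWith K u₀ D := by
    refine LipschitzOnWith.of_dist_le_mul fun x hx y hy => ?_
    exact le_of_tendsto ((hu₀ x hx).dist (hu₀ y hy))
      (.of_forall fun n => (hw n).lip.dist_le_mul x y)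
  obtain ⟨u, hu, hu'⟩ := hlip.extend_real
  have hconv : ∀ x ∈ D, Tendsto (fun n => w n x) atTop (𝓝 (u x)) := fun x hx => by
    rw [← hu' hx]
    exact hu₀ x hx
  have hzero : ∀ x ∉ rect a b, x ∈ D := fun x hx => ⟨0, by simp [(hw _).zero x hx]⟩
  have hvan : VanishingLip a b K u := by
    refine ⟨hu, fun x hx => tendsto_nhds_unique (hconv x (hzero x hx)) ?_⟩
    simp [(hw _).zero x hx]
  have hae : ∀ᵐ x, Tendsto (fun n => w n x) atTop (𝓝 (u x)) := by
    filter_upwards [(ae_restrict_iff' (measurableSet_rect a b)).1 hU] with x hx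
    by_cases h : x ∈ rect a b
    · exact hconv x ⟨_, hx h⟩
    · exact hconv x (hzero x h)
  let q : Plane → Plane := (rect a b).indicator p
  have hq : ∀ᵐ x, Tendsto (fun n => gradient (w n) x) atTop (𝓝 (q x)) := by
    filter_upwards [(ae_restrict_iff' (measurableSet_rect a b)).1 hp,
      ae_all_iff.2 fun n => (hw n).gradient_ae_zero] with x hx h0
    by_cases h : x ∈ rect a b
    · simpa [q, h] using hx h
    · simp [q, h, h0 _ h]
  refine ⟨u, hvan, hae, ?_⟩
  have hqK : ∀ᵐ x, ‖q x‖ ≤ K := by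
    filter_upwards [hq] with x hx
    exact le_of_tendsto hx.norm (.of_forall fun n => norm_gradient_le_of_lipschitz (hw n).lip x)
  have hqm : AEStronglyMeasurable q :=
    aestronglyMeasurable_of_tendsto_ae atTop
      (fun n => (measurable_gradient (w n)).aestronglyMeasurable) hq
  -- The limit of the gradients is the gradient of the limit: integration by parts against a smooth
  -- `ψ` passes to the limit on both sides.
  have hqu : q =ᵐ[volume] gradient u := by
    refine ae_eq_of_integral_contDiff_smul_eq
      ((memLp_top_of_bound hqm K hqK).locallyIntegrable le_top)
      ((memLp_top_of_bound (measurable_gradient u).aestronglyMeasurable K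
        (.of_forall (norm_gradient_le_of_lipschitz hu))).locallyIntegrable le_top) ?_
    intro ψ hψ hψc
    obtain ⟨D, hψl⟩ : ∃ D, LipschitzWith D ψ :=
      ContDiff.lipschitzWith_of_hasCompactSupport hψc hψ (by simp)
    rw [integral_smul_gradient hu hψl hψc]
    obtain ⟨B, hB⟩ := hψc.exists_bound_of_continuous hψ.continuous
    have h1 : Tendsto (fun n => ∫ x, ψ x • gradient (w n) x) atTop (𝓝 (∫ x, ψ x • q x)) := by
      refine tendsto_integral_of_bound_of_eq_zero (a := a) (b := b) (fun n =>
        hψ.continuous.aestronglyMeasurable.smul (measurable_gradient _).aestronglyMeasurable)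
        (B * K) (fun n => .of_forall fun x => ?_) (fun n => ?_) ?_
      · rw [norm_smul]
        exact mul_le_mul (hB x) (norm_gradient_le_of_lipschitz (hw n).lip x) (norm_nonneg _)
          ((norm_nonneg _).trans (hB x))
      · filter_upwards [(hw n).gradient_ae_zero] with x hx h
        simp [hx h]
      · filter_upwards [hq] with x hx using hx.const_smul _
    have h2 : Tendsto (fun n => ∫ x, w n x • gradient ψ x) atTop
        (𝓝 (∫ x, u x • gradient ψ x)) := by
      refine tendsto_integral_of_bound_of_eq_zero (a := a) (b := b) (fun n =>
        (hw n).lip.continuous.aestronglyMeasurable.smul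
          (measurable_gradient _).aestronglyMeasurable)
        (K * (|a| + |b|) * D) (fun n => .of_forall fun x => ?_) (fun n => ?_) ?_
      · rw [norm_smul]
        exact mul_le_mul ((hw n).abs_le x) (norm_gradient_le_of_lipschitz hψl x) (norm_nonneg _)
          (by positivity)
      · exact .of_forall fun x h => by simp [(hw n).zero x h]
      · filter_upwards [hae] with x hx using hx.smul_const _
    refine tendsto_nhds_unique h1 ?_
    simp only [integral_smul_gradient (hw _).lip hψl hψc]
    exact h2.neg
  filter_upwards [hq, hqu] with x hx h
  rwa [← h]

end VanishingLip

/-- The direct method, with uniform convexity in place of weak compactness: gradients of a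
minimizing sequence are Cauchy in `L²`, and values are too by Poincaré. The constraint bounds all
integrands, so the energy converges along an almost everywhere convergent subsequence. -/
theorem exists_energy_minimizer (hg : IsStiffness g c) (f a b : ℝ) (K : ℝ≥0) :
    ∃ u, VanishingLip a b K u ∧ ∀ v, VanishingLip a b K v → energy g f u ≤ energy g f v := by
  let S : Set ℝ := energy g f '' {v | VanishingLip a b K v}
  have hne : S.Nonempty :=
    ⟨_, 0, ⟨LipschitzWith.of_dist_le_mul fun x y => by simp; positivity, fun _ _ => rfl⟩, rfl⟩
  have hbdd : BddBelow S := by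
    refine ⟨-(|f| * (K * (|a| + |b|) * volume.real (rect a b))), ?_⟩
    rintro _ ⟨v, hv, rfl⟩
    have hv' : VanishingLip a b K v := hv
    rw [hv'.energy_eq hg]
    have h1 : 0 ≤ ∫ x, energyDensity g (gradient v x) :=
      integral_nonneg fun x => hg.energyDensity_nonneg _
    have h2 : ‖∫ x in rect a b, v x‖ ≤ K * (|a| + |b|) * volume.real (rect a b) :=
      norm_setIntegral_le_of_norm_le_const (volume_rect_lt_top a b) fun x _ => hv'.abs_le x
    rw [setIntegral_eq_integral_of_forall_compl_eq_zero hv'.zero] at h2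
    have h3 : f * ∫ x, v x ≤ |f| * ‖∫ x, v x‖ := by
      rw [Real.norm_eq_abs, ← abs_mul]
      exact le_abs_self _
    have h4 : |f| * ‖∫ x, v x‖ ≤ |f| * (K * (|a| + |b|) * volume.real (rect a b)) := by gcongr
    linarith
  have hm : ∀ v, VanishingLip a b K v → sInf S ≤ energy g f v := fun v hv =>
    csInf_le hbdd ⟨v, hv, rfl⟩
  have hseq : ∀ n : ℕ, ∃ v, VanishingLip a b K v ∧ energy g f v < sInf S + 1 / (n + 1) := by
    intro n
    obtain ⟨_, ⟨v, hv, rfl⟩, h⟩ := exists_lt_of_csInf_lt hne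
      (lt_add_of_pos_right (sInf S) (by positivity : (0 : ℝ) < 1 / (n + 1)))
    exact ⟨v, hv, h⟩
  choose w hw hwe using hseq
  -- The midpoint is admissible, so its energy is at least `sInf S`; the gap `c/8 ∫ |∇(wₙ - wₖ)|²`
  -- is then at most half the sum of the two excesses.
  have hdist : ∀ n k, ‖(hw n).toPair.2 - (hw k).toPair.2‖ ^ 2 ≤
      4 / c * (1 / (n + 1) + 1 / (k + 1)) := by
    intro n k
    have h1 := (hw n).energy_midpoint (f := f) hg (hw k)
    have h2 := hm _ ((hw n).add_mul_sub (hw k) (t := 1 / 2) (by norm_num) (by norm_num))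
    rw [VanishingLip.norm_toPair_snd_sub_sq (hw n) (hw k)]
    have h3 : c / 8 * ∫ x, ‖gradient (fun x => w n x - w k x) x‖ ^ 2 ≤
        (1 / (n + 1) + 1 / (k + 1)) / 2 := by linarith [hwe n, hwe k]
    have hc := hg.pos
    rw [div_mul_eq_mul_div, le_div_iff₀ hc]
    linarith
  have hlim0 : Tendsto (fun n : ℕ => 4 / c * (1 / ((n : ℝ) + 1) + 1 / (n + 1))) atTop (𝓝 0) := by
    have := (tendsto_one_div_add_atTop_nhds_zero_nat (𝕜 := ℝ)).add
      (tendsto_one_div_add_atTop_nhds_zero_nat (𝕜 := ℝ))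
    simpa using this.const_mul (4 / c)
  have hbound : ∀ N n : ℕ, N ≤ n → (1 : ℝ) / (n + 1) ≤ 1 / (N + 1) := fun N n h => by gcongr
  have hc := hg.pos
  have hcauchy2 : CauchySeq fun n => (hw n).toPair.2 := by
    refine cauchySeq_of_le_tendsto_0 (fun n : ℕ => √(4 / c * (1 / ((n : ℝ) + 1) + 1 / (n + 1))))
      (fun n k N hn hk => ?_) (by simpa using hlim0.sqrt)
    rw [dist_eq_norm]
    refine Real.le_sqrt_of_sq_le ((hdist n k).trans ?_)
    have := hbound N n hn
    have := hbound N k hk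
    gcongr
  have hcauchy1 : CauchySeq fun n => (hw n).toPair.1 := by
    refine cauchySeq_of_le_tendsto_0
      (fun n : ℕ => √(4 * a ^ 2 * (4 / c * (1 / ((n : ℝ) + 1) + 1 / (n + 1)))))
      (fun n k N hn hk => ?_) (by simpa using (hlim0.const_mul (4 * a ^ 2)).sqrt)
    rw [dist_eq_norm]
    refine Real.le_sqrt_of_sq_le
      ((VanishingLip.norm_toPair_fst_sub_sq_le (hw n) (hw k)).trans ?_)
    refine mul_le_mul_of_nonneg_left ((hdist n k).trans ?_) (by positivity)
    have := hbound N n hn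
    have := hbound N k hk
    gcongr
  obtain ⟨U, hU⟩ := cauchySeq_tendsto_of_complete hcauchy1
  obtain ⟨p, hp⟩ := cauchySeq_tendsto_of_complete hcauchy2
  -- Two successive subsequences: the first makes the values converge almost everywhere, the second
  -- also the gradients.
  obtain ⟨ns, hns, hnsU⟩ := (tendstoInMeasure_of_tendsto_Lp hU).exists_seq_tendsto_ae
  obtain ⟨ms, hms, hmsp⟩ :=
    (tendstoInMeasure_of_tendsto_Lp (hp.comp hns.tendsto_atTop)).exists_seq_tendsto_ae
  have hU' : ∀ᵐ x ∂volume.restrict (rect a b),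
      Tendsto (fun n => w (ns (ms n)) x) atTop (𝓝 (U x)) := by
    filter_upwards [hnsU, ae_all_iff.2 fun n => (hw n).memLp.coeFn_toLp] with x hx h
    refine (hx.comp hms.tendsto_atTop).congr fun n => ?_
    exact h _
  have hp' : ∀ᵐ x ∂volume.restrict (rect a b),
      Tendsto (fun n => gradient (w (ns (ms n))) x) atTop (𝓝 (p x)) := by
    filter_upwards [hmsp, ae_all_iff.2 fun n => (hw n).memLp_gradient.coeFn_toLp] with x hx h
    exact hx.congr fun n => h _
  obtain ⟨u, hu, hconv, hconv'⟩ := VanishingLip.exists_limit (fun n => hw (ns (ms n))) hU' hp'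
  refine ⟨u, hu, fun v hv => le_trans ?_ (hm v hv)⟩
  have hE : Tendsto (fun n => energy g f (w (ns (ms n)))) atTop (𝓝 (energy g f u)) := by
    refine tendsto_integral_of_bound_of_eq_zero (a := a) (b := b) (fun n => ?_)
      (g (K ^ 2) * K * K + |f| * (K * (|a| + |b|))) (fun n => .of_forall fun x => ?_)
      (fun n => ?_) ?_
    · exact ((hg.continuous_energyDensity.measurable.comp
        (measurable_gradient _)).aestronglyMeasurable).sub
        ((hw _).lip.continuous.aestronglyMeasurable.const_mul f)
    · refine (norm_sub_le _ _).trans (add_le_add ?_ ?_)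
      · rw [Real.norm_eq_abs, abs_of_nonneg (hg.energyDensity_nonneg _)]
        exact hg.energyDensity_le (norm_gradient_le_of_lipschitz (hw _).lip x)
      · rw [norm_mul, Real.norm_eq_abs]
        exact mul_le_mul_of_nonneg_left ((hw _).abs_le x) (abs_nonneg f)
    · filter_upwards [(hw (ns (ms n))).gradient_ae_zero] with x hx h
      simp [hx h, (hw _).zero x h]
    · filter_upwards [hconv, hconv'] with x h1 h2
      exact ((hg.continuous_energyDensity.tendsto _).comp h2).sub (h1.const_mul f)
  have hlim : Tendsto (fun n : ℕ => sInf S + 1 / ((n : ℝ) + 1)) atTop (𝓝 (sInf S)) := by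
    simpa using (tendsto_one_div_add_atTop_nhds_zero_nat (𝕜 := ℝ)).const_add (sInf S)
  exact le_of_tendsto_of_tendsto' hE
    ((hlim.comp hns.tendsto_atTop).comp hms.tendsto_atTop) fun n => (hwe _).le

/-- The variational inequality satisfied by a minimizer of the energy. -/
theorem variational_inequality (hg : IsStiffness g c) (hu : VanishingLip a b K u)
    (hmin : ∀ v, VanishingLip a b K v → energy g f u ≤ energy g f v)
    (hv : VanishingLip a b K v) {d : Plane → ℝ} (hd : ∀ x, d x = v x - u x) :
    f * ∫ x, d x ≤ ∫ x, inner ℝ (flux g (gradient u x)) (gradient d x) := by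
  obtain rfl : d = fun x => v x - u x := funext hd
  set d : Plane → ℝ := fun x => v x - u x
  have hdv : VanishingLip a b (K + K) d := hv.sub hu
  let t : ℕ → ℝ := fun n => 1 / ((n : ℝ) + 1)
  have ht0 : ∀ n, 0 < t n := fun n => by positivity
  have ht1 : ∀ n, t n ≤ 1 := fun n => by
    rw [div_le_one (by positivity)]
    simp
  let z : ℕ → Plane → ℝ := fun n x => u x + t n * (v x - u x)
  have hz : ∀ n, VanishingLip a b K (z n) := fun n => hu.add_mul_sub hv (ht0 n).le (ht1 n)
  have hgz : ∀ n, ∀ᵐ x, gradient (z n) x = gradient u x + t n • gradient d x := by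
    intro n
    filter_upwards [hu.lip.ae_differentiableAt (μ := volume),
      hdv.lip.ae_differentiableAt (μ := volume)] with x hx hy
    rw [← gradient_const_mul]
    have hy' : DifferentiableAt ℝ (fun x => t n * d x) x := hy.const_mul _
    simp only [gradient, z]
    rw [fderiv_fun_add hx hy', map_add]
  -- Convexity at the perturbed point `z n`, tested towards `u`, gives the inequality with the flux
  -- at `z n` after division by `t n`. Letting `t n → 0` then replaces differentiation of the
  -- energy.
  have hle : ∀ n, f * ∫ x, d x ≤ ∫ x, inner ℝ (flux g (gradient (z n) x)) (gradient d x) := by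
    intro n
    have h1 := hmin _ (hz n)
    rw [hu.energy_eq hg, (hz n).energy_eq hg] at h1
    have h2 : ∫ x, z n x = (∫ x, u x) + t n * ∫ x, d x := by
      rw [← integral_const_mul, ← integral_add hu.integrable (hdv.integrable.const_mul _)]
    have h3 : ∫ x, energyDensity g (gradient (z n) x) ≤ ∫ x, (energyDensity g (gradient u x) +
        t n * inner ℝ (flux g (gradient (z n) x)) (gradient d x)) := by
      refine integral_mono_ae ((hz n).integrable_energyDensity hg)
        ((hu.integrable_energyDensity hg).add
          ((VanishingLip.integrable_inner_gradient hg (hz n).lip hdv).const_mul _)) ?_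
      filter_upwards [hgz n] with x hx
      have h4 := hg.energyDensity_ge (gradient (z n) x) (gradient u x)
      have e : gradient u x - gradient (z n) x = -(t n • gradient d x) := by
        rw [hx]
        abel
      rw [e, inner_neg_right, inner_smul_right] at h4
      have h5 := hg.pos
      have h6 : 0 ≤ c / 2 * ‖-(t n • gradient d x)‖ ^ 2 := by positivity
      linarith
    rw [integral_add (hu.integrable_energyDensity hg)
      ((VanishingLip.integrable_inner_gradient hg (hz n).lip hdv).const_mul _),
      integral_const_mul] at h3
    rw [h2] at h1
    refine le_of_mul_le_mul_left ?_ (ht0 n)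
    linarith
  refine ge_of_tendsto' (tendsto_integral_of_bound_of_eq_zero (a := a) (b := b)
    (fun n => (VanishingLip.integrable_inner_gradient hg (hz n).lip hdv).aestronglyMeasurable)
    (g (K ^ 2) * K * (K + K : ℝ≥0)) (fun n => .of_forall fun x => ?_) (fun n => ?_) ?_) hle
  · have h1 := hg.norm_flux_le (norm_gradient_le_of_lipschitz (hz n).lip x)
    exact (norm_inner_le_norm _ _).trans (mul_le_mul h1
      (norm_gradient_le_of_lipschitz hdv.lip x) (norm_nonneg _) ((norm_nonneg _).trans h1))
  · filter_upwards [hdv.gradient_ae_zero] with x hx h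
    simp [hx h]
  · filter_upwards [ae_all_iff.2 hgz] with x hx
    refine Tendsto.inner ((hg.continuous_flux.tendsto _).comp ?_) tendsto_const_nhds
    simp only [hx]
    have : Tendsto t atTop (𝓝 0) := tendsto_one_div_add_atTop_nhds_zero_nat
    simpa using (this.smul_const (gradient d x)).const_add (gradient u x)

end Minimizer

theorem gradient_fun_neg (z : Plane → ℝ) (x : Plane) :
    gradient (fun x => -z x) x = -gradient z x := by
  have := gradient_const_mul (-1) z x
  simpa using this

/-! ### Comparison principle, barriers and the gradient bound -/

section Comparison

variable {g : ℝ → ℝ} {c a b f : ℝ} {K : ℝ≥0} {u z : Plane → ℝ}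

/-- Comparison principle for Lipschitz functions. -/
theorem le_of_integral_flux_le (hg : IsStiffness g c) {P Q : Plane → ℝ} {C D : ℝ≥0}
    (hP : LipschitzWith C P) (hQ : LipschitzWith D Q) (hPQ : ∀ x ∉ rect a b, P x ≤ Q x)
    (hz : ∀ x, z x = max (P x - Q x) 0)
    (h : ∫ x, inner ℝ (flux g (gradient P x)) (gradient z x) ≤
      ∫ x, inner ℝ (flux g (gradient Q x)) (gradient z x)) (x : Plane) : P x ≤ Q x := by
  obtain rfl : z = fun x => max (P x - Q x) 0 := funext hz
  set z : Plane → ℝ := fun x => max (P x - Q x) 0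
  have hzv : VanishingLip a b (C + D) z := VanishingLip.posPart_sub hP hQ hPQ
  have hIP := VanishingLip.integrable_inner_gradient hg hP hzv
  have hIQ := VanishingLip.integrable_inner_gradient hg hQ hzv
  have hI := hzv.integrable_norm_gradient_sq
  -- The gradient of `z` is `∇P - ∇Q` where `P > Q` and zero elsewhere, so strong monotonicity
  -- applies pointwise.
  have h1 : ∫ x, c * ‖gradient z x‖ ^ 2 ≤
      ∫ x, (inner ℝ (flux g (gradient P x)) (gradient z x) -
        inner ℝ (flux g (gradient Q x)) (gradient z x)) := by
    refine integral_mono_ae (hI.const_mul c) (hIP.sub hIQ) ?_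
    filter_upwards [ae_gradient_posPart (hP.sub hQ), ae_gradient_sub hP hQ] with x hx hs
    have hx' : gradient z x = {x | 0 < P x - Q x}.indicator (gradient fun x => P x - Q x) x := hx
    simp only [← inner_sub_left, hx']
    by_cases hpos : 0 < P x - Q x
    · simp only [indicator_of_mem (show x ∈ {x | 0 < P x - Q x} from hpos), hs]
      exact hg.flux_monotone _ _
    · rw [indicator_of_notMem (show x ∉ {x | 0 < P x - Q x} from hpos)]
      simp
  rw [integral_const_mul, integral_sub hIP hIQ] at h1
  have h2 : ∫ x, ‖gradient z x‖ ^ 2 = 0 := by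
    refine le_antisymm ?_ (integral_nonneg fun x => by positivity)
    have := hg.pos
    by_contra! hlt
    nlinarith [mul_pos this hlt]
  rw [integral_eq_zero_iff_of_nonneg (fun x => by positivity) hI] at h2
  have h3 := hzv.eq_zero_of_gradient_ae_zero (by filter_upwards [h2] with x hx; simpa using hx) x
  have h4 : P x - Q x ≤ z x := le_max_left _ _
  linarith

/-- The profile `τ(ℓ - τ)`, `τ` the truncation of `t` to `[0,ℓ]`. -/
def profile (ℓ t : ℝ) : ℝ := max 0 (min t ℓ) * (ℓ - max 0 (min t ℓ))

theorem profile_of_mem {ℓ t : ℝ} (ht : t ∈ Icc 0 ℓ) : profile ℓ t = t * (ℓ - t) := by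
  rw [profile, min_eq_left ht.2, max_eq_right ht.1]

theorem profile_nonneg {ℓ : ℝ} (hℓ : 0 ≤ ℓ) (t : ℝ) : 0 ≤ profile ℓ t :=
  mul_nonneg (le_max_left _ _) (sub_nonneg.2 (max_le hℓ (min_le_right _ _)))

theorem profile_sub_le {ℓ : ℝ} (hℓ : 0 ≤ ℓ) (s t : ℝ) :
    |profile ℓ s - profile ℓ t| ≤ ℓ * |s - t| := by
  have hs0 : 0 ≤ max 0 (min s ℓ) := le_max_left _ _
  have ht0 : 0 ≤ max 0 (min t ℓ) := le_max_left _ _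
  have hs1 : max 0 (min s ℓ) ≤ ℓ := max_le hℓ (min_le_right _ _)
  have ht1 : max 0 (min t ℓ) ≤ ℓ := max_le hℓ (min_le_right _ _)
  have hst : |max 0 (min s ℓ) - max 0 (min t ℓ)| ≤ |s - t| := by
    rw [max_comm 0, max_comm 0]
    refine (abs_max_sub_max_le_abs _ _ _).trans ?_
    have := abs_min_sub_min_le_max s ℓ t ℓ
    simpa using this
  simp only [profile]
  set σ := max 0 (min s ℓ)
  set τ := max 0 (min t ℓ)
  have e : σ * (ℓ - σ) - τ * (ℓ - τ) = (ℓ - σ - τ) * (σ - τ) := by ring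
  rw [e, abs_mul]
  have h2 : |ℓ - σ - τ| ≤ ℓ := abs_le.2 ⟨by linarith, by linarith⟩
  gcongr

theorem lipschitzWith_barrier {ℓ β : ℝ} (hℓ : 0 ≤ ℓ) (hβ : 0 ≤ β) (i : Fin 2) {K : ℝ≥0}
    (hK : β * ℓ ≤ K) : LipschitzWith K fun x : Plane => β * profile ℓ (x i) := by
  refine LipschitzWith.of_dist_le_mul fun x y => ?_
  rw [Real.dist_eq, ← mul_sub, abs_mul, abs_of_nonneg hβ, dist_eq_norm]
  have h1 := profile_sub_le hℓ (x i) (y i)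
  have h2 : |x i - y i| ≤ ‖x - y‖ := abs_apply_le_norm (x - y) i
  calc β * |profile ℓ (x i) - profile ℓ (y i)| ≤ β * (ℓ * ‖x - y‖) := by
        gcongr
        exact h1.trans (by gcongr)
    _ = β * ℓ * ‖x - y‖ := by ring
    _ ≤ K * ‖x - y‖ := by gcongr

theorem gradient_barrier {ℓ β : ℝ} (i : Fin 2) {x : Plane} (hx : x i ∈ Ioo 0 ℓ) :
    gradient (fun x : Plane => β * profile ℓ (x i)) x =
      (β * (ℓ - 2 * x i)) • EuclideanSpace.single i (1 : ℝ) := by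
  have hc : Continuous fun x : Plane => x i := by fun_prop
  have hev : (fun x : Plane => β * profile ℓ (x i)) =ᶠ[𝓝 x] fun x => β * (x i * (ℓ - x i)) := by
    filter_upwards [(isOpen_Ioo.preimage hc).mem_nhds hx] with y hy
    rw [profile_of_mem (Ioo_subset_Icc_self hy)]
  rw [hev.gradient_eq]
  have hp : HasFDerivAt (fun x : Plane => x i) (EuclideanSpace.proj i : Plane →L[ℝ] ℝ) x :=
    (EuclideanSpace.proj (𝕜 := ℝ) (i : Fin 2)).hasFDerivAt
  have hd := (hp.mul (hp.const_sub ℓ)).const_mul β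
  refine HasGradientAt.gradient ?_
  rw [hasGradientAt_iff_hasFDerivAt]
  convert! hd using 1
  ext y
  simp [PiLp.inner_apply]
  ring

/-- The weak form of `-∂ᵢE ≥ 0`. As `E` is only continuous, the derivative of `z` is written as a
limit of difference quotients, and a translation moves each quotient onto `E`, where it has a sign.
-/
theorem integral_antitone_mul_inner_gradient_nonneg {E : ℝ → ℝ} (hE : Continuous E)
    (hE' : Antitone E) (i : Fin 2) (hz : LipschitzWith K z) (hzc : HasCompactSupport z)
    (hz0 : ∀ x, 0 ≤ z x) :
    0 ≤ ∫ x : Plane, E (x i) * inner ℝ (gradient z x) (EuclideanSpace.single i 1) := by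
  set e : Plane := EuclideanSpace.single i 1
  have hEc : Continuous fun x : Plane => E (x i) := hE.comp (by fun_prop)
  have hlim := hz.integral_inv_smul_sub_mul_tendsto_integral_lineDeriv_mul' (μ := volume)
    hzc hEc e
  have hcongr : ∫ x : Plane, lineDeriv ℝ z x e * E (x i) =
      ∫ x : Plane, E (x i) * inner ℝ (gradient z x) e := by
    refine integral_congr_ae ?_
    filter_upwards [ae_lineDeriv_eq_inner_gradient hz e] with x hx
    rw [hx, mul_comm]
  rw [hcongr] at hlim
  refine ge_of_tendsto hlim ?_
  filter_upwards [self_mem_nhdsWithin] with t (ht : 0 < t)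
  have h1 : ∫ x : Plane, z (x + t • e) * E (x i) = ∫ x : Plane, z x * E (x i - t) := by
    rw [← integral_add_right_eq_self (fun x : Plane => z x * E (x i - t)) (t • e)]
    refine integral_congr_ae (.of_forall fun x => ?_)
    simp [e]
  have hi1 : Integrable fun x : Plane => z (x + t • e) * E (x i) := by
    refine ((hz.continuous.comp (continuous_add_const _)).mul hEc).integrable_of_hasCompactSupport ?_
    exact (hzc.comp_homeomorph (Homeomorph.addRight (t • e))).mul_right
  have hi2 : Integrable fun x : Plane => z x * E (x i) :=
    (hz.continuous.mul hEc).integrable_of_hasCompactSupport hzc.mul_right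
  have hi3 : Integrable fun x : Plane => z x * E (x i - t) :=
    (hz.continuous.mul (hE.comp (by fun_prop))).integrable_of_hasCompactSupport hzc.mul_right
  have h2 : ∫ x : Plane, (t⁻¹ • (z (x + t • e) - z x)) * E (x i) =
      t⁻¹ * ∫ x : Plane, z x * (E (x i - t) - E (x i)) := by
    simp only [smul_eq_mul, mul_assoc, integral_const_mul]
    congr 1
    simp only [sub_mul, mul_sub]
    rw [integral_sub hi1 hi2, integral_sub hi3 hi2, h1]
  rw [h2]
  refine mul_nonneg (by positivity) (integral_nonneg fun x => mul_nonneg (hz0 x) ?_)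
  exact sub_nonneg.2 (hE' (by linarith))

/-- The quadratic barrier is a supersolution. -/
theorem le_integral_flux_barrier (hg : IsStiffness g c) {ℓ β : ℝ} (hβ : 0 ≤ β) (i : Fin 2)
    (hrect : ∀ x ∈ rect a b, x i ∈ Ioo 0 ℓ) (hz : VanishingLip a b K z) (hz0 : ∀ x, 0 ≤ z x) :
    2 * c * β * ∫ x, z x ≤
      ∫ x, inner ℝ (flux g (gradient (fun x : Plane => β * profile ℓ (x i)) x))
        (gradient z x) := by
  let r : ℝ → ℝ := fun t => β * (ℓ - 2 * t)
  let E : ℝ → ℝ := fun t => g (r t ^ 2) * r t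
  have hr : Continuous r := by fun_prop
  have hE : Continuous E := (hg.cont.comp (hr.pow 2)).mul hr
  set e : Plane := EuclideanSpace.single i 1
  have he : ‖e‖ = 1 := by simp [e]
  have hflux : ∀ s : ℝ, flux g (s • e) = (g (s ^ 2) * s) • e := fun s => by
    simp [flux, norm_smul, he, mul_smul]
  -- Strong monotonicity of the flux along `e` gives `E s - E t ≥ c (r s - r t) = 2cβ (t - s)`. Thus
  -- minus the divergence of the barrier's flux is at least `2cβ` in the weak sense.
  have hanti : Antitone fun t => E t + 2 * c * β * t := by
    intro s t hst
    have hrs : r t ≤ r s := by simp only [r]; gcongr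
    have h1 := hg.flux_monotone (r s • e) (r t • e)
    rw [hflux, hflux, ← sub_smul, ← sub_smul, real_inner_smul_left, real_inner_smul_right,
      real_inner_self_eq_norm_sq, norm_smul, he, Real.norm_eq_abs, mul_one, sq_abs] at h1
    have h2 : c * (r s - r t) ≤ E s - E t := by
      rcases hrs.eq_or_lt with h | h
      · simp [E, h]
      · have : 0 < r s - r t := sub_pos.2 h
        refine le_of_mul_le_mul_right ?_ this
        simp only [E]
        linarith
    simp only [r] at h2 ⊢
    linarith
  have h1 : ∫ x, inner ℝ (flux g (gradient (fun x : Plane => β * profile ℓ (x i)) x))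
      (gradient z x) = ∫ x : Plane, E (x i) * inner ℝ (gradient z x) e := by
    refine integral_congr_ae ?_
    filter_upwards [hz.gradient_ae_zero] with x hx
    by_cases h : x ∈ rect a b
    · rw [gradient_barrier i (hrect x h)]
      rw [hflux, real_inner_smul_left, real_inner_comm]
    · simp [hx h]
  have h2 := integral_antitone_mul_inner_gradient_nonneg
    (E := fun t => E t + 2 * c * β * t) (by fun_prop) hanti i hz.lip hz.hasCompactSupport hz0
  have hInt : ∀ F : ℝ → ℝ, Continuous F →
      Integrable fun x : Plane => F (x i) * inner ℝ (gradient z x) e := by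
    intro F hF
    obtain ⟨B, hB⟩ := (isCompact_Icc (a := 0) (b := ℓ)).exists_bound_of_continuousOn
      hF.continuousOn
    refine integrable_of_bound_of_eq_zero (a := a) (b := b) ?_ (|B| * K) ?_ ?_
    · exact ((hF.comp (by fun_prop : Continuous fun x : Plane => x i)).measurable.mul
        ((measurable_gradient z).inner measurable_const)).aestronglyMeasurable
    · filter_upwards [hz.gradient_ae_zero] with x hx
      by_cases h : x ∈ rect a b
      · have h1 := (hB _ (Ioo_subset_Icc_self (hrect x h))).trans (le_abs_self B)
        have h2 := (norm_inner_le_norm (𝕜 := ℝ) (gradient z x) e)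
        rw [he, mul_one] at h2
        rw [norm_mul]
        exact mul_le_mul h1 (h2.trans (norm_gradient_le_of_lipschitz hz.lip x)) (norm_nonneg _)
          (abs_nonneg _)
      · simp only [hx h, inner_zero_left, mul_zero, norm_zero]
        positivity
    · filter_upwards [hz.gradient_ae_zero] with x hx h
      simp [hx h]
  have h3 := integral_coord_mul_inner_gradient i hz.lip hz.hasCompactSupport
  have h4 : ∫ x : Plane, (E (x i) + 2 * c * β * x i) * inner ℝ (gradient z x) e =
      (∫ x : Plane, E (x i) * inner ℝ (gradient z x) e) - 2 * c * β * ∫ x, z x := by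
    simp only [add_mul, mul_assoc (2 * c * β)]
    rw [integral_add (hInt E hE) ((hInt (fun t => t) continuous_id).const_mul _),
      integral_const_mul, h3]
    ring
  rw [h1]
  linarith

/-- The gradient bound: a solution of the variational inequality among `K`-Lipschitz functions
is `L`-Lipschitz, with `L` given by the quadratic barriers. -/
theorem lipschitzWith_of_variational_inequality (hg : IsStiffness g c) (ha : 0 < a) (hb : 0 < b)
    (hf : 0 ≤ f) (hu : VanishingLip a b K u)
    (hVI : ∀ v, VanishingLip a b K v → ∀ d : Plane → ℝ, (∀ x, d x = v x - u x) →
      f * ∫ x, d x ≤ ∫ x, inner ℝ (flux g (gradient u x)) (gradient d x))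
    {L : ℝ≥0} (hLK : L ≤ K) (hLa : f / (2 * c) * a ≤ L) (hLb : f / (2 * c) * b ≤ L) :
    (∀ x, 0 ≤ u x) ∧ LipschitzWith L u := by
  have hc := hg.pos
  -- Chosen so that the supersolution bound `2cβ` equals the load `f`.
  set β := f / (2 * c) with hβ
  have hβ0 : 0 ≤ β := by positivity
  have hβf : 2 * c * β = f := by rw [hβ]; field_simp
  have hnonneg : ∀ x, 0 ≤ u x := by
    -- The negative part of `u` is the variation towards the admissible competitor `max u 0`.
    let z : Plane → ℝ := fun x => max (0 - u x) 0
    have h0 : LipschitzWith 0 fun _ : Plane => (0 : ℝ) := LipschitzWith.const 0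
    refine le_of_integral_flux_le (a := a) (b := b) (z := z) hg h0 hu.lip
      (fun x hx => (hu.zero x hx).ge) (fun x => rfl) ?_
    have h1 := hVI (fun x => max (u x) 0)
      ⟨lipschitzWith_posPart hu.lip, fun x hx => by simp [hu.zero x hx]⟩ z fun x => by
        simp only [z]
        rcases le_total (u x) 0 with h | h
        · rw [max_eq_left (by linarith), max_eq_right h]
        · rw [max_eq_right (by linarith), max_eq_left h, sub_self]
    have h2 : 0 ≤ f * ∫ x, z x := mul_nonneg hf (integral_nonneg fun x => le_max_right _ _)
    simp only [gradient_fun_const, flux_zero, inner_zero_left, integral_zero]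
    exact h2.trans h1
  have hbarrier : ∀ (ℓ : ℝ) (i : Fin 2), 0 ≤ ℓ → β * ℓ ≤ L → (∀ x ∈ rect a b, x i ∈ Ioo 0 ℓ) →
      ∀ x, u x ≤ β * profile ℓ (x i) := by
    intro ℓ i hℓ hβℓ hrect
    have hB := lipschitzWith_barrier hℓ hβ0 i hβℓ
    set B : Plane → ℝ := fun x => β * profile ℓ (x i)
    have hB0 : ∀ x, 0 ≤ B x := fun x => mul_nonneg hβ0 (profile_nonneg hℓ _)
    have hout : ∀ x ∉ rect a b, u x ≤ B x := fun x hx => by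
      rw [hu.zero x hx]
      exact hB0 x
    let z : Plane → ℝ := fun x => max (u x - B x) 0
    have hz : VanishingLip a b (K + L) z := VanishingLip.posPart_sub hu.lip hB hout
    refine le_of_integral_flux_le (a := a) (b := b) (z := z) hg hu.lip hB hout (fun x => rfl) ?_
    -- The competitor `min u B` is admissible since `L ≤ K` keeps the minimum `K`-Lipschitz.
    have h1 := hVI (fun x => min (u x) (B x))
      ⟨by simpa [max_eq_left hLK] using hu.lip.min hB,
        fun x hx => by rw [hu.zero x hx, min_eq_left (hB0 x)]⟩ (fun x => -z x) fun x => by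
        simp only [z]
        rcases le_total (u x) (B x) with h | h
        · rw [max_eq_right (by linarith), min_eq_left h]
          ring
        · rw [max_eq_left (by linarith), min_eq_right h]
          ring
    have h2 := le_integral_flux_barrier hg hβ0 i hrect hz fun x => le_max_right _ _
    simp only [gradient_fun_neg, inner_neg_right, integral_neg] at h1
    rw [hβf] at h2
    linarith
  -- If `x` is outside the rectangle, some coordinate leaves its interval. The barrier in that
  -- coordinate is at most `βℓ` times the distance of `x + h` to the crossed side, hence at most
  -- `L‖h‖`.
  have hbound : ∀ x h : Plane, x ∉ rect a b → u (x + h) ≤ L * ‖h‖ := by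
    intro x h hx
    by_cases hxh : x + h ∈ rect a b
    · have main : ∀ (ℓ : ℝ) (i : Fin 2), 0 ≤ ℓ → β * ℓ ≤ L →
          (∀ x ∈ rect a b, x i ∈ Ioo 0 ℓ) → x i ∉ Ioo 0 ℓ → u (x + h) ≤ L * ‖h‖ := by
        intro ℓ i hℓ hβℓ hrect hxi
        have h1 := hbarrier ℓ i hℓ hβℓ hrect (x + h)
        have h2 := hrect _ hxh
        rw [profile_of_mem (Ioo_subset_Icc_self h2)] at h1
        have h3 := abs_le.1 (abs_apply_le_norm h i)
        have h4 : (x + h) i = x i + h i := rfl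
        have h5 : (x + h) i * (ℓ - (x + h) i) ≤ ℓ * ‖h‖ := by
          rcases le_or_gt (x i) 0 with h6 | h6
          · have h7 : (x + h) i ≤ ‖h‖ := by linarith
            have h8 := h2.1
            have h9 := h2.2
            nlinarith
          · have h7 : ℓ ≤ x i := by
              by_contra! h
              exact hxi ⟨h6, h⟩
            have h8 : ℓ - (x + h) i ≤ ‖h‖ := by linarith
            have h9 := h2.1
            have h10 := h2.2
            nlinarith
        calc u (x + h) ≤ β * (ℓ * ‖h‖) := h1.trans (by gcongr)
          _ = β * ℓ * ‖h‖ := by ring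
          _ ≤ L * ‖h‖ := by gcongr
      by_cases hx0 : x 0 ∈ Ioo 0 a
      · exact main b 1 hb.le hLb (fun x hx => hx.2) fun h => hx ⟨hx0, h⟩
      · exact main a 0 ha.le hLa (fun x hx => hx.1) hx0
    · rw [hu.zero _ hxh]
      positivity
  -- Translates solve the same problem on a shifted rectangle. The variations `max(u, u(·+h) -
  -- L‖h‖)` and, shifted back by `h`, `min(u, u(·-h) + L‖h‖)` give the upper and lower bounds for `f
  -- ∫ z` that the comparison of `P` with `Q` needs.
  have htrans : ∀ x h : Plane, u (x + h) ≤ u x + L * ‖h‖ := by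
    intro x₀ h
    let P : Plane → ℝ := fun x => u (x + h)
    let Q : Plane → ℝ := fun x => u x + L * ‖h‖
    have hP : LipschitzWith K P := lipschitzWith_comp_add_right hu.lip h
    have hQ : LipschitzWith K Q := by simpa using hu.lip.add (LipschitzWith.const (L * ‖h‖))
    have hPQ : ∀ x ∉ rect a b, P x ≤ Q x := fun x hx => by
      simp only [P, Q, hu.zero x hx, zero_add]
      exact hbound x h hx
    let z : Plane → ℝ := fun x => max (P x - Q x) 0
    refine le_of_integral_flux_le (a := a) (b := b) (z := z) hg hP hQ hPQ (fun x => rfl) ?_ x₀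
    have hQg : gradient Q = gradient u := gradient_add_const u _
    have hPg : ∀ x, gradient P x = gradient u (x + h) := gradient_comp_add_right u h
    have h1 := hVI (fun x => max (u x) (P x - L * ‖h‖)) ⟨by
      simpa using hu.lip.max (hP.sub (LipschitzWith.const (L * ‖h‖))), fun x hx => by
        have := hPQ x hx
        simp only [Q, hu.zero x hx] at this ⊢
        exact max_eq_left (by linarith)⟩ z fun x => by
      simp only [z, Q]
      rcases le_total (u x) (P x - L * ‖h‖) with h | h
      · rw [max_eq_left (by linarith), max_eq_right h]
        ring
      · rw [max_eq_right (by linarith), max_eq_left h, sub_self]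
    let R : Plane → ℝ := fun x => u (x + -h)
    have hR : LipschitzWith K R := lipschitzWith_comp_add_right hu.lip (-h)
    have h2 := hVI (fun x => min (u x) (R x + L * ‖h‖)) ⟨by
      simpa using hu.lip.min (hR.add (LipschitzWith.const (L * ‖h‖))), fun x hx => by
        rw [hu.zero x hx]
        refine min_eq_left (add_nonneg (hnonneg _) (by positivity))⟩
      (fun x => -z (x + -h)) fun x => by
      simp only [z, Q, P, neg_add_cancel_right]
      change -max (u x - (R x + L * ‖h‖)) 0 = _
      rcases le_total (u x) (R x + L * ‖h‖) with h | h
      · rw [max_eq_right (by linarith), min_eq_left h]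
        ring
      · rw [max_eq_left (by linarith), min_eq_right h]
        ring
    rw [hQg]
    simp only [hPg]
    simp only [gradient_fun_neg, inner_neg_right, integral_neg, gradient_comp_add_right] at h2
    rw [integral_add_right_eq_self (fun x => z x) (-h),
      ← integral_add_right_eq_self (fun x => inner ℝ (flux g (gradient u x))
        (gradient z (x + -h))) h] at h2
    simp only [add_neg_cancel_right] at h2
    linarith
  refine ⟨hnonneg, LipschitzWith.of_le_add_mul _ fun x y => ?_⟩
  have := htrans y (x - y)
  rwa [add_sub_cancel, ← dist_eq_norm] at this

/-- Existence of a Lipschitz solution of the Euler–Lagrange equation. -/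
theorem exists_lipschitz_solution (hg : IsStiffness g c) (ha : 0 < a) (hb : 0 < b) (hf : 0 ≤ f) :
    ∃ (L : ℝ≥0) (u : Plane → ℝ), VanishingLip a b L u ∧ (∀ x, 0 ≤ u x) ∧
      ∀ ψ, IsTest a b ψ →
        ∫ x, inner ℝ (flux g (gradient u x)) (gradient ψ x) = f * ∫ x, ψ x := by
  have hc := hg.pos
  set L : ℝ≥0 := (f / (2 * c) * a + f / (2 * c) * b).toNNReal
  have hL : (L : ℝ) = f / (2 * c) * a + f / (2 * c) * b := Real.coe_toNNReal _ (by positivity)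
  -- The extra `1` is the slack that leaves room for variations once `u` is known to be
  -- `L`-Lipschitz.
  obtain ⟨u, hu, hmin⟩ := exists_energy_minimizer hg f a b (L + 1)
  have hVI : ∀ v, VanishingLip a b (L + 1) v → ∀ d : Plane → ℝ, (∀ x, d x = v x - u x) →
      f * ∫ x, d x ≤ ∫ x, inner ℝ (flux g (gradient u x)) (gradient d x) :=
    fun v hv d hd => variational_inequality hg hu hmin hv hd
  obtain ⟨hu0, hul⟩ := lipschitzWith_of_variational_inequality hg ha hb hf hu hVI
    (L := L) (by simp) (by rw [hL]; simp; positivity) (by rw [hL]; simp; positivity)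
  refine ⟨L, u, ⟨hul, hu.zero⟩, hu0, ?_⟩
  have key : ∀ ψ, IsTest a b ψ →
      f * ∫ x, ψ x ≤ ∫ x, inner ℝ (flux g (gradient u x)) (gradient ψ x) := by
    rintro ψ ⟨hψ, hψc, hψs⟩
    obtain ⟨D, hD⟩ : ∃ D, LipschitzWith D ψ :=
      ContDiff.lipschitzWith_of_hasCompactSupport hψc hψ (by simp)
    -- Small enough that `t ψ` is `1`-Lipschitz, so that `u + t ψ` is `(L + 1)`-Lipschitz.
    let t : ℝ := (D + 1 : ℝ)⁻¹
    have ht : 0 < t := by positivity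
    have htD : t * D ≤ 1 := by
      rw [inv_mul_le_iff₀ (by positivity)]
      simp
    have h := hVI (fun x => u x + t * ψ x) ⟨?_, fun x hx => ?_⟩ (fun x => t * ψ x)
      fun x => by ring
    · simp only [gradient_const_mul, inner_smul_right, integral_const_mul] at h
      refine le_of_mul_le_mul_left ?_ ht
      linarith
    · refine LipschitzWith.of_dist_le_mul fun x y => ?_
      have h1 := hul.dist_le_mul x y
      have h2 := hD.dist_le_mul x y
      rw [Real.dist_eq] at h1 h2 ⊢
      have e : u x + t * ψ x - (u y + t * ψ y) = (u x - u y) + t * (ψ x - ψ y) := by ring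
      rw [e]
      refine (abs_add_le _ _).trans ?_
      rw [abs_mul, abs_of_pos ht]
      have h3 : t * |ψ x - ψ y| ≤ t * D * dist x y := by
        rw [mul_assoc]
        gcongr
      have h4 : t * D * dist x y ≤ 1 * dist x y := by gcongr
      push_cast
      linarith
    · have : ψ x = 0 := image_eq_zero_of_notMem_tsupport fun h => hx (hψs h)
      simp [hu.zero x hx, this]
  intro ψ hψ
  refine le_antisymm ?_ (key ψ hψ)
  have hneg : IsTest a b fun x => -ψ x := by
    refine ⟨hψ.1.neg, hψ.2.1.neg, ?_⟩
    have : tsupport (fun x => -ψ x) = tsupport ψ := tsupport_neg ψ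
    rw [this]
    exact hψ.2.2
  have h := key _ hneg
  simp only [gradient_fun_neg, inner_neg_right, integral_neg] at h
  linarith

end Comparison

theorem tendsto_toLp_of_bound {α E : Type*} [MeasurableSpace α] {μ : Measure α}
    [IsFiniteMeasure μ] [NormedAddCommGroup E] [InnerProductSpace ℝ E] {F : ℕ → α → E} {f : α → E}
    (hF : ∀ n, MemLp (F n) 2 μ) (hf : MemLp f 2 μ) (C : ℝ) (hC : ∀ n, ∀ᵐ x ∂μ, ‖F n x‖ ≤ C)
    (hlim : ∀ᵐ x ∂μ, Tendsto (fun n => F n x) atTop (𝓝 (f x))) :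
    Tendsto (fun n => (hF n).toLp (F n)) atTop (𝓝 (hf.toLp f)) := by
  rw [tendsto_iff_norm_sub_tendsto_zero]
  have hC' : ∀ᵐ x ∂μ, ‖f x‖ ≤ C := by
    filter_upwards [hlim, ae_all_iff.2 hC] with x hx h
    exact le_of_tendsto hx.norm (.of_forall h)
  have h1 : Tendsto (fun n => ∫ x, ‖F n x - f x‖ ^ 2 ∂μ) atTop (𝓝 (∫ _, (0 : ℝ) ∂μ)) := by
    refine tendsto_integral_of_dominated_convergence (fun _ => (C + C) ^ 2) (fun n => ?_)
      (integrable_const _) (fun n => ?_) ?_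
    · exact ((hF n).1.sub hf.1).norm.pow 2
    · filter_upwards [hC n, hC'] with x h1 h2
      rw [Real.norm_eq_abs, abs_of_nonneg (by positivity)]
      have := norm_sub_le (F n x) (f x)
      gcongr
      linarith
    · filter_upwards [hlim] with x hx
      have := (hx.sub_const (f x)).norm.pow 2
      simpa using this
  have h2 : ∀ n, ‖(hF n).toLp (F n) - hf.toLp f‖ = √(∫ x, ‖F n x - f x‖ ^ 2 ∂μ) := by
    intro n
    rw [← MemLp.toLp_sub, ← Real.sqrt_sq (norm_nonneg _), norm_toLp_sq]
    simp
  simp only [h2]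
  simpa using h1.sqrt

/-! ### Approximation of Lipschitz functions by test functions -/

section Density

variable {a b : ℝ} {K : ℝ≥0} {u w ψ : Plane → ℝ}

theorem IsTest.exists_vanishingLip (hψ : IsTest a b ψ) : ∃ K : ℝ≥0, VanishingLip a b K ψ := by
  obtain ⟨D, hD⟩ : ∃ D, LipschitzWith D ψ :=
    ContDiff.lipschitzWith_of_hasCompactSupport hψ.2.1 hψ.1 (by simp)
  exact ⟨D, hD, fun x hx => image_eq_zero_of_notMem_tsupport fun h => hx (hψ.2.2 h)⟩

theorem VanishingLip.toPair_mem_testPairs (hw : VanishingLip a b K w) (ht : IsTest a b w) :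
    hw.toPair ∈ testPairs a b :=
  ⟨w, ht, hw.memLp.coeFn_toLp, hw.memLp_gradient.coeFn_toLp⟩

/-- The derivative is put on `w` rather than on the bump, by differentiation under the integral.
Gradients of mollifications then inherit the bound `K` and converge at almost every point. -/
theorem hasGradientAt_convolution (hw : VanishingLip a b K w) (η : ContDiffBump (0 : Plane))
    (x : Plane) :
    HasGradientAt (η.normed volume ⋆[ContinuousLinearMap.lsmul ℝ ℝ, volume] w)
      ((η.normed volume ⋆[ContinuousLinearMap.lsmul ℝ ℝ, volume] gradient w) x) x := by
  have hη := η.continuous_normed (μ := volume)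
  have hηi : Integrable (η.normed volume) := η.integrable_normed
  have hae : ∀ᵐ t : Plane, DifferentiableAt ℝ w (x - t) :=
    (quasiMeasurePreserving_sub_left volume x).ae (hw.lip.ae_differentiableAt (μ := volume))
  have key := hasFDerivAt_integral_of_dominated_loc_of_lip (𝕜 := ℝ) (μ := volume) (x₀ := x)
    (F := fun y t => η.normed volume t * w (y - t)) (s := univ)
    (F' := fun t => η.normed volume t • fderiv ℝ w (x - t))
    (bound := fun t => η.normed volume t * K) univ_mem
    (.of_forall fun y => (hη.mul (hw.lip.continuous.comp (by fun_prop))).aestronglyMeasurable)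
    ?_ ?_ (.of_forall fun t => ?_) (hηi.mul_const _) ?_
  · rw [hasGradientAt_iff_hasFDerivAt]
    convert! key.2 using 1
    have hi : Integrable fun t => η.normed volume t • gradient w (x - t) :=
      hηi.smul_of_top_left (memLp_top_of_bound ((measurable_gradient w).comp
        (measurable_const.sub measurable_id)).aestronglyMeasurable K
        (.of_forall fun t => norm_gradient_le_of_lipschitz hw.lip _))
    ext y
    rw [InnerProductSpace.toDual_apply_apply, ContinuousLinearMap.integral_apply key.1,
      convolution_def, real_inner_comm]
    simp only [ContinuousLinearMap.lsmul_apply]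
    rw [← integral_inner hi]
    simp [real_inner_comm _ y, real_inner_smul_left, inner_gradient_left]
  · exact (hη.mul (hw.lip.continuous.comp (by fun_prop))).integrable_of_hasCompactSupport
      η.hasCompactSupport_normed.mul_right
  · exact hη.aestronglyMeasurable.smul
      ((measurable_fderiv ℝ w).comp (measurable_const.sub measurable_id)).aestronglyMeasurable
  · refine LipschitzWith.lipschitzOnWith (LipschitzWith.of_dist_le_mul fun y z => ?_)
    have h1 := hw.lip.dist_le_mul (y - t) (z - t)
    rw [dist_sub_right] at h1
    rw [Real.dist_eq] at h1 ⊢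
    rw [← mul_sub, abs_mul, Real.coe_nnabs, abs_mul, abs_of_nonneg K.coe_nonneg, mul_assoc]
    gcongr
  · filter_upwards [hae] with t ht
    have h1 : HasFDerivAt (fun y => w (y - t)) (fderiv ℝ w (x - t)) x :=
      ht.hasFDerivAt.comp x ((hasFDerivAt_id x).sub_const t)
    exact h1.const_mul _

/-- Mollification of a Lipschitz function with compact support in the rectangle. -/
theorem toPair_mem_closure_of_tsupport_subset (hw : VanishingLip a b K w)
    (hs : tsupport w ⊆ rect a b) : hw.toPair ∈ closure (testPairs a b) := by
  obtain ⟨δ, hδ, hδs⟩ := hw.hasCompactSupport.isCompact.exists_cthickening_subset_open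
    (isOpen_rect a b) hs
  let ε : ℕ → ℝ := fun n => δ / (n + 1)
  have hε : ∀ n, 0 < ε n := fun n => by positivity
  have hεδ : ∀ n, ε n ≤ δ := fun n => div_le_self hδ.le (by simp)
  have hε0 : Tendsto ε atTop (𝓝 0) := by
    simpa [ε, div_eq_mul_inv] using
      (tendsto_one_div_add_atTop_nhds_zero_nat (𝕜 := ℝ)).const_mul δ
  -- The radii have the fixed ratio `2`, the bound required for almost everywhere convergence of the
  -- mollified gradient.
  let η : ℕ → ContDiffBump (0 : Plane) := fun n =>
    ⟨ε n / 2, ε n, by linarith [hε n], by linarith [hε n]⟩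
  let ψ : ℕ → Plane → ℝ := fun n =>
    (η n).normed volume ⋆[ContinuousLinearMap.lsmul ℝ ℝ, volume] w
  have hloc : LocallyIntegrable (gradient w) volume :=
    (memLp_top_of_bound (measurable_gradient w).aestronglyMeasurable K
        (.of_forall (norm_gradient_le_of_lipschitz hw.lip))).locallyIntegrable le_top
  have hconv : ∀ {E : Type} [NormedAddCommGroup E] [NormedSpace ℝ E] (F : Plane → E) (C : ℝ) (n : ℕ)
      (x : Plane), (∀ x, ‖F x‖ ≤ C) →
      ‖((η n).normed volume ⋆[ContinuousLinearMap.lsmul ℝ ℝ, volume] F) x‖ ≤ C := by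
    intro E _ _ F C n x hF
    rw [convolution_def]
    refine (norm_integral_le_of_norm_le ((η n).integrable_normed.mul_const C)
      (.of_forall fun t => ?_)).trans ?_
    · rw [ContinuousLinearMap.lsmul_apply, norm_smul, Real.norm_eq_abs,
        abs_of_nonneg ((η n).nonneg_normed t)]
      exact mul_le_mul_of_nonneg_left (hF _) ((η n).nonneg_normed t)
    · rw [integral_mul_const, (η n).integral_normed, one_mul]
  have htest : ∀ n, IsTest a b (ψ n) := by
    intro n
    have hc : HasCompactSupport ((η n).normed (volume : Measure Plane)) :=
      (η n).hasCompactSupport_normed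
    refine ⟨hc.contDiff_convolution_left _ (η n).contDiff_normed
      hw.lip.continuous.locallyIntegrable, hc.convolution _ hw.hasCompactSupport, ?_⟩
    refine Subset.trans (closure_minimal ?_ Metric.isClosed_cthickening) hδs
    refine (support_convolution_subset_swap _).trans ?_
    rintro _ ⟨y, hy, t, ht, rfl⟩
    rw [(η n).support_normed_eq, mem_ball_zero_iff] at ht
    refine Metric.mem_cthickening_of_dist_le _ y _ _ (subset_tsupport _ hy) ?_
    simpa using ht.le.trans (hεδ n)
  have hgrad : ∀ n, gradient (ψ n) =
      (η n).normed volume ⋆[ContinuousLinearMap.lsmul ℝ ℝ, volume] gradient w :=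
    fun n => gradient_eq (hasGradientAt_convolution hw (η n))
  choose D hD using fun n => (htest n).exists_vanishingLip
  refine mem_closure_of_tendsto (b := atTop) (f := fun n => (hD n).toPair) ?_
    (.of_forall fun n => (hD n).toPair_mem_testPairs (htest n))
  refine Tendsto.prodMk_nhds ?_ ?_
  · refine tendsto_toLp_of_bound _ _ (K * (|a| + |b|))
      (fun n => .of_forall fun x => hconv w _ n x hw.abs_le) (.of_forall fun x => ?_)
    exact ContDiffBump.convolution_tendsto_right_of_continuous hε0 hw.lip.continuous x
  · refine tendsto_toLp_of_bound _ _ K (fun n => .of_forall fun x => ?_) (ae_restrict_of_ae ?_)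
    · rw [hgrad]
      exact hconv _ _ n x (norm_gradient_le_of_lipschitz hw.lip)
    · simp only [hgrad]
      exact ContDiffBump.ae_convolution_tendsto_right_of_locallyIntegrable (K := 2) hε0
        (.of_forall fun n => by simp [η]; linarith) hloc

/-- Nonnegative Lipschitz functions vanishing outside the rectangle are limits of test functions. -/
theorem toPair_mem_closure (hu : VanishingLip a b K u) (hu0 : ∀ x, 0 ≤ u x) :
    hu.toPair ∈ closure (testPairs a b) := by
  let δ : ℕ → ℝ := fun n => 1 / ((n : ℝ) + 1)
  have hδ : ∀ n, 0 < δ n := fun n => by positivity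
  have hδ0 : Tendsto δ atTop (𝓝 0) := tendsto_one_div_add_atTop_nhds_zero_nat
  -- Lowering by `δ n` puts the support in the closed set `{u ≥ δ n}`, which lies inside the open
  -- rectangle.
  let w : ℕ → Plane → ℝ := fun n x => max (u x - δ n) 0
  have hl : ∀ n, LipschitzWith K fun x => u x - δ n := fun n => by
    simpa using hu.lip.sub (LipschitzWith.const (δ n))
  have hw : ∀ n, VanishingLip a b K (w n) := fun n =>
    ⟨lipschitzWith_posPart (hl n), fun x hx =>
      max_eq_right (by rw [hu.zero x hx]; linarith [hδ n])⟩
  have hs : ∀ n, tsupport (w n) ⊆ rect a b := by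
    intro n
    refine (closure_minimal (t := {x | δ n ≤ u x}) (fun x hx => ?_)
      (isClosed_le continuous_const hu.lip.continuous)).trans fun x hx => ?_
    · by_contra h
      exact hx (max_eq_right (by simp at h; linarith))
    · by_contra h
      have h1 : δ n ≤ u x := hx
      rw [hu.zero x h] at h1
      linarith [hδ n]
  refine isClosed_closure.mem_of_tendsto (b := atTop) (f := fun n => (hw n).toPair) ?_
    (.of_forall fun n => toPair_mem_closure_of_tsupport_subset (hw n) (hs n))
  refine Tendsto.prodMk_nhds ?_ ?_
  · refine tendsto_toLp_of_bound _ _ (K * (|a| + |b|))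
      (fun n => .of_forall (hw n).abs_le) (.of_forall fun x => ?_)
    have := (hδ0.const_sub (u x)).max (tendsto_const_nhds (x := (0 : ℝ)))
    simpa [w, max_eq_left (hu0 x)] using this
  · refine tendsto_toLp_of_bound _ _ K (fun n => .of_forall
      (norm_gradient_le_of_lipschitz (hw n).lip)) (ae_restrict_of_ae ?_)
    filter_upwards [ae_all_iff.2 fun n => ae_gradient_posPart (hl n), ae_gradient_eq_zero hu.lip]
      with x hx h0
    have hx' : ∀ n, gradient (w n) x = {x | 0 < u x - δ n}.indicator (gradient u) x := fun n => by
      rw [show gradient (w n) x = _ from hx n]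
      have : gradient (fun x => u x - δ n) = gradient u := by
        simpa [sub_eq_add_neg] using gradient_add_const u (-δ n)
      rw [this]
    simp only [hx']
    -- Where `u = 0` all truncated gradients vanish, and so does the gradient of `u` almost
    -- everywhere; where `u > 0` the indicator is eventually `1`.
    rcases (hu0 x).eq_or_lt with h | h
    · rw [h0 h.symm]
      refine tendsto_const_nhds.congr fun n => ?_
      rw [indicator_of_notMem]
      change ¬0 < u x - δ n
      linarith [hδ n]
    · refine tendsto_const_nhds.congr' ?_
      filter_upwards [hδ0.eventually_lt_const h] with n hn
      rw [indicator_of_mem]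
      simpa using hn

end Density

theorem integral_inner_eq_inner_toLp {α E : Type*} [MeasurableSpace α] {μ : Measure α}
    [NormedAddCommGroup E] [InnerProductSpace ℝ E] {q : α → E} (hq : MemLp q 2 μ) (w : Lp E 2 μ) :
    ∫ x, inner ℝ (q x) (w x) ∂μ = inner ℝ (hq.toLp q) w := by
  rw [L2.inner_def]
  refine integral_congr_ae ?_
  filter_upwards [hq.coeFn_toLp] with x hx
  rw [hx]

theorem continuous_integral_inner {α E : Type*} [MeasurableSpace α] {μ : Measure α}
    [NormedAddCommGroup E] [InnerProductSpace ℝ E] {q : α → E} (hq : MemLp q 2 μ) :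
    Continuous fun w : Lp E 2 μ => ∫ x, inner ℝ (q x) (w x) ∂μ := by
  simp only [integral_inner_eq_inner_toLp hq]
  fun_prop

theorem integrable_inner_of_memLp {α E : Type*} [MeasurableSpace α] {μ : Measure α}
    [NormedAddCommGroup E] [InnerProductSpace ℝ E] {q : α → E} (hq : MemLp q 2 μ) (w : Lp E 2 μ) :
    Integrable (fun x => inner ℝ (q x) (w x)) μ := by
  refine (L2.integrable_inner (𝕜 := ℝ) (hq.toLp q) w).congr ?_
  filter_upwards [hq.coeFn_toLp] with x hx
  rw [hx]

/-! ### The space `H¹₀` as a closure -/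

section Sobolev

variable {a b : ℝ}

theorem continuous_integral_fst (a b : ℝ) :
    Continuous fun w : L2Pair a b => ∫ x in rect a b, w.1 x := by
  have h := continuous_integral_inner (μ := volume.restrict (rect a b)) (memLp_const (1 : ℝ))
  simpa [Function.comp_def] using h.comp
    (continuous_fst (Y := Lp Plane 2 (volume.restrict (rect a b))))

theorem isClosed_H1 (a b : ℝ) : IsClosed (H1 a b) := by
  simp only [H1, ofPred_forall]
  refine isClosed_iInter fun ψ => isClosed_iInter fun hψ => isClosed_iInter fun e => ?_
  obtain ⟨K, hK⟩ := hψ.exists_vanishingLip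
  have h1 : MemLp (fun x => inner ℝ (gradient ψ x) e) 2 (volume.restrict (rect a b)) :=
    hK.memLp_gradient.inner_const e
  have h2 : MemLp (fun x => ψ x • e) 2 (volume.restrict (rect a b)) := by
    refine MemLp.of_bound (hK.lip.continuous.smul continuous_const).aestronglyMeasurable
      (K * (|a| + |b|) * ‖e‖) (.of_forall fun x => ?_)
    rw [norm_smul]
    exact mul_le_mul_of_nonneg_right (hK.abs_le x) (norm_nonneg _)
  have c1 := (continuous_integral_inner h1).comp
    (continuous_fst (Y := Lp Plane 2 (volume.restrict (rect a b))))
  have c2 := (continuous_integral_inner h2).comp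
    (continuous_snd (X := Lp ℝ 2 (volume.restrict (rect a b))))
  convert! isClosed_eq c1 c2.neg using 3 with w
  simp [real_inner_smul_left, real_inner_comm e, mul_comm]

theorem testPairs_subset_H1 (a b : ℝ) : testPairs a b ⊆ H1 a b := by
  rintro w ⟨η, hη, h1, h2⟩ ψ hψ e
  obtain ⟨K, hK⟩ := hψ.exists_vanishingLip
  obtain ⟨C, hC⟩ := hη.exists_vanishingLip
  have key := integral_inner_gradient_mul hC.lip hK.lip hK.hasCompactSupport e
  rw [eq_comm, neg_eq_iff_eq_neg] at key
  calc ∫ x in rect a b, w.1 x * inner ℝ (gradient ψ x) e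
      = ∫ x in rect a b, η x * inner ℝ (gradient ψ x) e := by
        refine integral_congr_ae ?_
        filter_upwards [h1] with x hx
        rw [hx]
    _ = ∫ x, η x * inner ℝ (gradient ψ x) e :=
        setIntegral_eq_integral_of_forall_compl_eq_zero fun x hx => by simp [hC.zero x hx]
    _ = - ∫ x, inner ℝ (gradient η x) e * ψ x := key
    _ = - ∫ x in rect a b, inner ℝ (gradient η x) e * ψ x := by
        rw [setIntegral_eq_integral_of_forall_compl_eq_zero fun x hx => by simp [hK.zero x hx]]
    _ = - ∫ x in rect a b, inner ℝ (w.2 x) e * ψ x := by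
        congr 1
        refine integral_congr_ae ?_
        filter_upwards [h2] with x hx
        rw [hx]

/-- The weak gradient condition is closed and holds for test pairs, so intersecting with `H1`
removes nothing. Closed conditions on `H10` need checking only on test functions. -/
theorem H10_eq_closure (a b : ℝ) : H10 a b = closure (testPairs a b) :=
  inter_eq_right.2 ((isClosed_H1 a b).closure_subset_iff.2 (testPairs_subset_H1 a b))

theorem sub_mem_H10 {w w' : L2Pair a b} (hw : w ∈ H10 a b) (hw' : w' ∈ H10 a b) :
    w - w' ∈ H10 a b := by
  rw [H10_eq_closure] at *
  refine map_mem_closure₂ continuous_sub hw hw' ?_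
  rintro w ⟨ψ, hψ, h1, h2⟩ w' ⟨ψ', hψ', h1', h2'⟩
  refine ⟨fun x => ψ x - ψ' x, ⟨hψ.1.sub hψ'.1, hψ.2.1.sub hψ'.2.1, ?_⟩, ?_, ?_⟩
  · exact (tsupport_sub ψ ψ').trans (union_subset hψ.2.2 hψ'.2.2)
  · filter_upwards [Lp.coeFn_sub w.1 w'.1, h1, h1'] with x hx h h'
    rw [Prod.fst_sub, hx, Pi.sub_apply, h, h']
  · filter_upwards [Lp.coeFn_sub w.2 w'.2, h2, h2'] with x hx h h'
    rw [Prod.snd_sub, hx, Pi.sub_apply, h, h']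
    simp only [gradient]
    rw [fderiv_fun_sub (hψ.1.differentiable (by simp) x) (hψ'.1.differentiable (by simp) x),
      map_sub]

/-- The Poincaré inequality in `H¹₀`. -/
theorem norm_fst_le_of_mem_H10 {w : L2Pair a b} (hw : w ∈ H10 a b) :
    ‖w.1‖ ≤ 2 * |a| * ‖w.2‖ := by
  rw [H10_eq_closure] at hw
  have hcl : IsClosed {w : L2Pair a b | ‖w.1‖ ≤ 2 * |a| * ‖w.2‖} :=
    isClosed_le (by fun_prop) (by fun_prop)
  refine (hcl.closure_subset_iff (s := testPairs a b)).2 ?_ hw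
  rintro w ⟨ψ, hψ, h1, h2⟩
  obtain ⟨K, hK⟩ := hψ.exists_vanishingLip
  have e1 : w.1 = hK.memLp.toLp ψ := Lp.ext (h1.trans hK.memLp.coeFn_toLp.symm)
  have e2 : w.2 = hK.memLp_gradient.toLp (gradient ψ) :=
    Lp.ext (h2.trans hK.memLp_gradient.coeFn_toLp.symm)
  have key := hK.integral_sq_le
  rw [← setIntegral_eq_integral_of_forall_compl_eq_zero (s := rect a b)
    (f := fun x => ψ x ^ 2) fun x hx => by simp [hK.zero x hx],
    ← setIntegral_eq_integral_of_ae_compl_eq_zero (s := rect a b)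
    (f := fun x => ‖gradient ψ x‖ ^ 2) (by
      filter_upwards [hK.gradient_ae_zero] with x hx h
      simp [hx h]), ← norm_toLp_sq hK.memLp_gradient] at key
  have e3 := norm_toLp_sq hK.memLp
  simp only [Real.norm_eq_abs, sq_abs] at e3
  rw [← e3] at key
  change ‖w.1‖ ≤ 2 * |a| * ‖w.2‖
  rw [e1, e2]
  refine abs_le_of_sq_le_sq' ?_ (by positivity) |>.2
  rw [mul_pow, mul_pow, sq_abs]
  linarith

end Sobolev

/-! ### The Ramberg–Osgood function -/

section Plasticity

/-- Without the case split, continuity and monotonicity in `s` and continuity in `θ` can be read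
off. -/
theorem plasticity_eq (θ : Param) (s : ℝ) :
    plasticity θ s = 1 / θ.1.2.2 * max (s / θ.1.2.1) 1 ^ ((1 - θ.1.1) / 2) := by
  have hξ := θ.2.2.1
  rw [plasticity]
  split_ifs with h
  · rw [max_eq_right ((div_le_one hξ).2 h), Real.one_rpow, mul_one]
  · rw [max_eq_left ((one_le_div hξ).2 (not_le.1 h).le)]

/-- Since `κ ≤ 1` the exponent is nonnegative, so the function increases from its initial value
`1/G`. -/
theorem isStiffness_plasticity (θ : Param) : IsStiffness (plasticity θ) (1 / θ.1.2.2) := by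
  have hξ := θ.2.2.1
  have hG := θ.2.2.2
  have hκ : 0 ≤ (1 - θ.1.1) / 2 := by linarith [θ.2.1.2]
  refine ⟨by positivity, ?_, fun s t hst => ?_, fun s => ?_⟩
  · simp only [funext (plasticity_eq θ)]
    refine continuous_const.mul (Continuous.rpow_const (by fun_prop) fun s => Or.inr hκ)
  · rw [plasticity_eq, plasticity_eq]
    gcongr
  · rw [plasticity_eq]
    refine le_mul_of_one_le_right (by positivity) (Real.one_le_rpow (le_max_right _ _) hκ)

theorem continuous_plasticity_param (s : ℝ) : Continuous fun θ : Param => plasticity θ s := by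
  have h1 : Continuous fun θ : Param => θ.1.1 := by fun_prop
  have h2 : Continuous fun θ : Param => θ.1.2.1 := by fun_prop
  have h3 : Continuous fun θ : Param => θ.1.2.2 := by fun_prop
  simp only [plasticity_eq]
  refine (continuous_const.div h3 fun θ => θ.2.2.2.ne').mul (Continuous.rpow
    ((continuous_const.div h2 fun θ => θ.2.2.1.ne').max continuous_const)
    ((continuous_const.sub h1).div_const 2) fun θ => Or.inl ?_)
  exact (lt_of_lt_of_le one_pos (le_max_right _ _)).ne'

end Plasticity

/-! ### Existence, uniqueness and continuous dependence of the weak solution -/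

section WeakSolution

variable {a b φ : ℝ} {θ θ' : Param} {w w' : L2Pair a b}

theorem plasticity_mul_inner (θ : Param) (p q : Plane) :
    plasticity θ (‖p‖ ^ 2) * inner ℝ p q = inner ℝ (flux (plasticity θ) p) q := by
  rw [flux, real_inner_smul_left]

theorem memLp_flux {g : ℝ → ℝ} {c : ℝ} (hg : IsStiffness g c)
    {p : Lp Plane 2 (volume.restrict (rect a b))} {L : ℝ}
    (hp : ∀ᵐ x ∂volume.restrict (rect a b), ‖p x‖ ≤ L) :
    MemLp (fun x => flux g (p x)) 2 (volume.restrict (rect a b)) :=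
  MemLp.of_bound (hg.continuous_flux.comp_aestronglyMeasurable (Lp.aestronglyMeasurable p))
    (g (L ^ 2) * L) (by filter_upwards [hp] with x hx using hg.norm_flux_le hx)

/-- A bounded gradient makes the flux bounded, hence both sides of the equation are `L²`-continuous
in `v` and the equation passes from test functions to `H10`. The bound is recorded for the
continuity in `θ`. -/
theorem exists_bounded_isWeakSolution (ha : 0 < a) (hb : 0 < b) (θ : Param) (hφ : 0 ≤ φ) :
    ∃ w : L2Pair a b, IsWeakSolution a b θ φ w ∧
      ∃ L : ℝ, ∀ᵐ x ∂volume.restrict (rect a b), ‖w.2 x‖ ≤ L := by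
  have hg := isStiffness_plasticity θ
  obtain ⟨L, u, hu, hu0, hEL⟩ := exists_lipschitz_solution hg ha hb (by positivity : 0 ≤ 2 * φ)
  have hgrad : hu.toPair.2 =ᵐ[volume.restrict (rect a b)] gradient u :=
    hu.memLp_gradient.coeFn_toLp
  have hL : ∀ᵐ x ∂volume.restrict (rect a b), ‖hu.toPair.2 x‖ ≤ L := by
    filter_upwards [hgrad] with x hx
    rw [hx]
    exact norm_gradient_le_of_lipschitz hu.lip x
  have hq := memLp_flux hg hL
  refine ⟨hu.toPair, ⟨?_, fun v hv => ?_⟩, L, hL⟩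
  · rw [H10_eq_closure]
    exact toPair_mem_closure hu hu0
  simp only [plasticity_mul_inner]
  refine ⟨integrable_inner_of_memLp hq v.2, ?_⟩
  rw [H10_eq_closure] at hv
  have hcl : IsClosed {v : L2Pair a b |
      ∫ x in rect a b, inner ℝ (flux (plasticity θ) (hu.toPair.2 x)) (v.2 x) =
        2 * φ * ∫ x in rect a b, v.1 x} :=
    isClosed_eq ((continuous_integral_inner hq).comp continuous_snd)
      (continuous_const.mul (continuous_integral_fst a b))
  refine (hcl.closure_subset_iff (s := testPairs a b)).2 ?_ hv
  rintro v ⟨ψ, hψ, h1, h2⟩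
  obtain ⟨K, hK⟩ := hψ.exists_vanishingLip
  have e1 : ∫ x in rect a b, v.1 x = ∫ x, ψ x := by
    rw [integral_congr_ae h1, setIntegral_eq_integral_of_forall_compl_eq_zero hK.zero]
  change _ = _
  rw [e1, ← hEL ψ hψ, ← setIntegral_eq_integral_of_ae_compl_eq_zero (s := rect a b)
    (f := fun x => inner ℝ (flux (plasticity θ) (gradient u x)) (gradient ψ x))]
  · refine integral_congr_ae ?_
    filter_upwards [hgrad, h2] with x hx hx'
    rw [hx, hx']
  · filter_upwards [hK.gradient_ae_zero] with x hx h
    simp [hx h]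

/-- Energy estimate for the difference of two weak solutions. -/
theorem IsWeakSolution.norm_sub_sq_le (hw : IsWeakSolution a b θ φ w)
    (hw' : IsWeakSolution a b θ' φ w')
    (hInt : IntegrableOn (fun x => inner ℝ (flux (plasticity θ) (w'.2 x)) ((w - w').2 x))
      (rect a b)) :
    1 / θ.1.2.2 * ‖(w - w').2‖ ^ 2 ≤
      (∫ x in rect a b, inner ℝ (flux (plasticity θ') (w'.2 x)) ((w - w').2 x)) -
      ∫ x in rect a b, inner ℝ (flux (plasticity θ) (w'.2 x)) ((w - w').2 x) := by
  -- Both equations are tested with `w - w'`; their right sides agree because `φ` is the same.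
  have hv := sub_mem_H10 hw.1 hw'.1
  obtain ⟨i1, e1⟩ := hw.2 _ hv
  obtain ⟨i2, e2⟩ := hw'.2 _ hv
  simp only [plasticity_mul_inner] at i1 e1 i2 e2
  rw [e2, ← e1, ← integral_sub i1 hInt, ← real_inner_self_eq_norm_sq, L2.inner_def,
    ← integral_const_mul]
  refine integral_mono_ae ((L2.integrable_inner (𝕜 := ℝ) _ _).const_mul _) (i1.sub hInt) ?_
  filter_upwards [Lp.coeFn_sub w.2 w'.2] with x hx
  simp only [Prod.snd_sub, hx, Pi.sub_apply, ← inner_sub_left, real_inner_self_eq_norm_sq]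
  exact (isStiffness_plasticity θ).flux_monotone _ _

/-- For equal parameters the right side of `IsWeakSolution.norm_sub_sq_le` vanishes, so the
gradients agree, and Poincaré's inequality gives the values. No gradient bound is needed. -/
theorem IsWeakSolution.unique (hw : IsWeakSolution a b θ φ w) (hw' : IsWeakSolution a b θ φ w') :
    w = w' := by
  have hv := sub_mem_H10 hw.1 hw'.1
  have hInt := (hw'.2 _ hv).1
  simp only [plasticity_mul_inner] at hInt
  have h := hw.norm_sub_sq_le hw' hInt
  rw [sub_self] at h
  have hG : 0 < 1 / θ.1.2.2 := one_div_pos.2 θ.2.2.2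
  have h2 : ‖(w - w').2‖ = 0 := by
    refine pow_eq_zero_iff two_ne_zero |>.1 (le_antisymm ?_ (sq_nonneg _))
    by_contra! hlt
    nlinarith [mul_pos hG hlt]
  have h1 : ‖(w - w').1‖ = 0 :=
    le_antisymm ((norm_fst_le_of_mem_H10 hv).trans (by rw [h2, mul_zero])) (norm_nonneg _)
  rw [norm_eq_zero] at h1 h2
  exact sub_eq_zero.1 (Prod.ext h1 h2)

theorem existsUnique_isWeakSolution (ha : 0 < a) (hb : 0 < b) (θ : Param) (hφ : 0 ≤ φ) :
    ∃! w : L2Pair a b, IsWeakSolution a b θ φ w := by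
  obtain ⟨w, hw, -⟩ := exists_bounded_isWeakSolution ha hb θ hφ
  exact ⟨w, hw, fun w' hw' => hw'.unique hw⟩

theorem isWeakSolution_solution (ha : 0 < a) (hb : 0 < b) (θ : Param) (hφ : 0 ≤ φ) :
    IsWeakSolution a b θ φ (solution a b θ φ) :=
  Classical.epsilon_spec (existsUnique_isWeakSolution ha hb θ hφ).exists

theorem exists_bound_solution (ha : 0 < a) (hb : 0 < b) (θ : Param) (hφ : 0 ≤ φ) :
    ∃ L : ℝ, ∀ᵐ x ∂volume.restrict (rect a b), ‖(solution a b θ φ).2 x‖ ≤ L := by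
  obtain ⟨w, hw, hL⟩ := exists_bounded_isWeakSolution ha hb θ hφ
  rwa [(isWeakSolution_solution ha hb θ hφ).unique hw]

/-- The energy estimate compares two fluxes at the gradient of the limit solution only. That
gradient is bounded, so the fluxes converge in `L²` by dominated convergence, with no bound uniform
in the varying parameters. -/
theorem continuous_solution (ha : 0 < a) (hb : 0 < b) (hφ : 0 ≤ φ) :
    Continuous fun θ : Param => solution a b θ φ := by
  refine continuous_iff_seqContinuous.2 fun θs θ hθ => ?_
  obtain ⟨L, hL⟩ := exists_bound_solution ha hb θ hφ
  have hw := fun n => isWeakSolution_solution ha hb (θs n) hφ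
  have hw' := isWeakSolution_solution ha hb θ hφ
  set w' := solution a b θ φ
  set w : ℕ → L2Pair a b := fun n => solution a b (θs n) φ
  have hq := fun n => memLp_flux (isStiffness_plasticity (θs n)) hL
  have hq' := memLp_flux (isStiffness_plasticity θ) hL
  have hpl : ∀ s, Tendsto (fun n => plasticity (θs n) s) atTop (𝓝 (plasticity θ s)) := fun s =>
    ((continuous_plasticity_param s).tendsto θ).comp hθ
  have hG : Tendsto (fun n => (θs n).1.2.2) atTop (𝓝 θ.1.2.2) :=
    ((by fun_prop : Continuous fun θ : Param => θ.1.2.2).tendsto θ).comp hθ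
  have hQ : Tendsto (fun n => ‖(hq n).toLp _ - hq'.toLp _‖) atTop (𝓝 0) := by
    rw [← tendsto_iff_norm_sub_tendsto_zero]
    -- At gradients of norm at most `L` the flux is at most `g(L²) L`, a convergent and hence
    -- bounded sequence in `n`.
    obtain ⟨C, hC⟩ := ((hpl (L ^ 2)).mul_const L).bddAbove_range
    refine tendsto_toLp_of_bound hq hq' C (fun n => ?_) (.of_forall fun x => ?_)
    · filter_upwards [hL] with x hx
      exact ((isStiffness_plasticity (θs n)).norm_flux_le hx).trans (hC ⟨n, rfl⟩)
    · exact (hpl _).smul_const _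
  have hest : ∀ n, ‖(w n - w').2‖ ≤ (θs n).1.2.2 * ‖(hq n).toLp _ - hq'.toLp _‖ := by
    intro n
    have h := (hw n).norm_sub_sq_le hw' (integrable_inner_of_memLp (hq n) _)
    rw [integral_inner_eq_inner_toLp hq', integral_inner_eq_inner_toLp (hq n),
      ← inner_sub_left] at h
    have h2 := h.trans (real_inner_le_norm _ _)
    rw [norm_sub_rev] at h2
    have hGn := (θs n).2.2.2
    rcases (norm_nonneg (w n - w').2).eq_or_lt with h0 | h0
    · rw [← h0]
      positivity
    · rw [one_div, inv_mul_le_iff₀ hGn, sq, ← mul_assoc] at h2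
      exact le_of_mul_le_mul_right h2 h0
  have hlim2 : Tendsto (fun n => ‖(w n - w').2‖) atTop (𝓝 0) :=
    squeeze_zero (fun n => norm_nonneg _) hest (by simpa using hG.mul hQ)
  have hlim1 : Tendsto (fun n => ‖(w n - w').1‖) atTop (𝓝 0) :=
    squeeze_zero (fun n => norm_nonneg _)
      (fun n => norm_fst_le_of_mem_H10 (sub_mem_H10 (hw n).1 hw'.1))
      (by simpa using hlim2.const_mul (2 * |a|))
  rw [tendsto_iff_norm_sub_tendsto_zero]
  simpa [Prod.norm_def] using hlim1.max hlim2

theorem continuous_observe (ha : 0 < a) (hb : 0 < b) {M : ℕ} {φ : Fin M → ℝ}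
    (hφ : ∀ i, 0 ≤ φ i) : Continuous (observe a b φ) := by
  refine (PiLp.continuous_toLp 2 _).comp (continuous_pi fun i => continuous_const.mul ?_)
  exact (continuous_integral_fst a b).comp (continuous_solution ha hb (hφ i))

end WeakSolution

/-! ### The Gaussian noise density -/

section Gaussian

theorem neg_half_mul_norm_inv_smul_sq {M : ℕ} {σ : ℝ} (hσ : 0 < σ) (x : Data M) :
    -(1 / 2) * ‖σ⁻¹ • x‖ ^ 2 = -(1 / (2 * σ ^ 2)) * ‖x‖ ^ 2 := by
  rw [norm_smul, mul_pow, norm_inv, inv_pow, Real.norm_eq_abs, sq_abs]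
  field_simp

theorem integral_exp_neg_half_sq_pos {M : ℕ} {σ : ℝ} (hσ : 0 < σ) :
    0 < ∫ x : Data M, Real.exp (-(1 / 2) * ‖σ⁻¹ • x‖ ^ 2) := by
  have e := neg_half_mul_norm_inv_smul_sq (M := M) hσ
  simp only [e]
  rw [GaussianFourier.integral_rexp_neg_mul_sq_norm (by positivity)]
  positivity

/-- The density of the isotropic Gaussian measure. -/
theorem multivariateGaussian_eq_withDensity {M : ℕ} {σ : ℝ} (hσ : 0 < σ) :
    multivariateGaussian 0 (σ ^ 2 • (1 : Matrix (Fin M) (Fin M) ℝ)) =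
      volume.withDensity fun x : Data M =>
        ENNReal.ofReal ((∫ x : Data M, Real.exp (-(1 / 2) * ‖σ⁻¹ • x‖ ^ 2))⁻¹) *
        ENNReal.ofReal (Real.exp (-(1 / 2) * ‖σ⁻¹ • x‖ ^ 2)) := by
  have hN := integral_exp_neg_half_sq_pos (M := M) hσ
  have e := neg_half_mul_norm_inv_smul_sq (M := M) hσ
  set N := ∫ x : Data M, Real.exp (-(1 / 2) * ‖σ⁻¹ • x‖ ^ 2) with hNdef
  have hmeas : Measurable fun x : Data M =>
      ENNReal.ofReal N⁻¹ * ENNReal.ofReal (Real.exp (-(1 / 2) * ‖σ⁻¹ • x‖ ^ 2)) := by fun_prop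
  have hb : (0 : ℝ) < 1 / (2 * σ ^ 2) := by positivity
  have hInt : Integrable fun x : Data M => Real.exp (-(1 / 2) * ‖σ⁻¹ • x‖ ^ 2) :=
    Integrable.of_integral_ne_zero hN.ne'
  have hfin : IsFiniteMeasure (volume.withDensity fun x : Data M =>
      ENNReal.ofReal N⁻¹ * ENNReal.ofReal (Real.exp (-(1 / 2) * ‖σ⁻¹ • x‖ ^ 2))) := by
    refine isFiniteMeasure_withDensity ?_
    rw [lintegral_const_mul _ (by fun_prop), ← ofReal_integral_eq_lintegral_ofReal hInt
      (.of_forall fun x => (Real.exp_pos _).le)]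
    exact ENNReal.mul_ne_top ENNReal.ofReal_ne_top ENNReal.ofReal_ne_top
  have hpsd : (σ ^ 2 • (1 : Matrix (Fin M) (Fin M) ℝ)).PosSemidef :=
    Matrix.PosSemidef.one.smul (by positivity)
  -- Both measures have the same characteristic function. The normalization stays an unevaluated
  -- integral `N`, which equals the constant in the Gaussian Fourier integral and so cancels.
  refine Measure.ext_of_charFun (funext fun t => ?_)
  rw [charFun_multivariateGaussian hpsd, charFun_apply,
    integral_withDensity_eq_integral_toReal_smul hmeas
      (.of_forall fun x => ENNReal.mul_lt_top ENNReal.ofReal_lt_top ENNReal.ofReal_lt_top)]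
  have h1 : ∀ x : Data M, (ENNReal.ofReal N⁻¹ *
      ENNReal.ofReal (Real.exp (-(1 / 2) * ‖σ⁻¹ • x‖ ^ 2))).toReal •
      Complex.exp (inner ℝ x t * Complex.I) = (N : ℂ)⁻¹ *
      Complex.exp (-((1 / (2 * σ ^ 2) : ℝ) : ℂ) * ‖x‖ ^ 2 + Complex.I * (inner ℝ t x : ℝ)) := by
    intro x
    rw [ENNReal.toReal_mul, ENNReal.toReal_ofReal (by positivity),
      ENNReal.toReal_ofReal (Real.exp_pos _).le, e, Complex.exp_add, real_inner_comm,
      mul_comm Complex.I]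
    simp only [Complex.real_smul]
    push_cast
    ring
  simp only [h1]
  rw [integral_const_mul, GaussianFourier.integral_cexp_neg_mul_sq_norm_add
    (by rwa [Complex.ofReal_re])]
  have h2 : (N : ℂ) = (Real.pi / ((1 / (2 * σ ^ 2) : ℝ) : ℂ)) ^
      (Module.finrank ℝ (Data M) / 2 : ℂ) := by
    rw [hNdef]
    simp only [e]
    rw [GaussianFourier.integral_rexp_neg_mul_sq_norm hb, ← Complex.ofReal_div,
      Complex.ofReal_cpow (by positivity)]
    simp
  rw [← h2, ← mul_assoc, inv_mul_cancel₀ (by exact_mod_cast hN.ne'), one_mul]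
  congr 1
  have h3 : t.ofLp ⬝ᵥ (σ ^ 2 • (1 : Matrix (Fin M) (Fin M) ℝ)).mulVec t.ofLp = σ ^ 2 * ‖t‖ ^ 2 := by
    rw [Matrix.smul_mulVec, Matrix.one_mulVec, dotProduct_smul, smul_eq_mul,
      EuclideanSpace.norm_sq_eq]
    simp [dotProduct, sq]
  rw [h3]
  have hσ' : (σ : ℂ) ≠ 0 := by exact_mod_cast hσ.ne'
  simp
  field_simp
  norm_num

end Gaussian

/-! ### Bayes' rule and the conditional law -/

section Bayes

variable {M : ℕ} {F : Param → Data M} {σ : ℝ} {μ₀ : Measure Param}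

theorem likelihood_pos (F : Param → Data M) (σ : ℝ) (y : Data M) (θ : Param) :
    0 < likelihood F σ y θ := Real.exp_pos _

theorem likelihood_le_one (F : Param → Data M) (σ : ℝ) (y : Data M) (θ : Param) :
    likelihood F σ y θ ≤ 1 := by
  rw [likelihood, Real.exp_le_one_iff]
  have := sq_nonneg ‖σ⁻¹ • (y - F θ)‖
  linarith

theorem measurable_likelihood (hF : Measurable F) (σ : ℝ) :
    Measurable fun p : Data M × Param => likelihood F σ p.1 p.2 := by
  unfold likelihood
  fun_prop

theorem measurable_likelihood_right (hF : Measurable F) (σ : ℝ) (y : Data M) :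
    Measurable (likelihood F σ y) := by
  unfold likelihood
  fun_prop

theorem integrable_likelihood [IsFiniteMeasure μ₀] (hF : Measurable F) (σ : ℝ) (y : Data M) :
    Integrable (likelihood F σ y) μ₀ :=
  Integrable.of_bound (measurable_likelihood_right hF σ y).aestronglyMeasurable 1
    (.of_forall fun θ => by
      rw [Real.norm_eq_abs, abs_of_pos (likelihood_pos F σ y θ)]
      exact likelihood_le_one F σ y θ)

theorem integral_likelihood_pos [IsProbabilityMeasure μ₀] (hF : Measurable F) (σ : ℝ)
    (y : Data M) : 0 < ∫ θ, likelihood F σ y θ ∂μ₀ :=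
  integral_exp_pos (integrable_likelihood hF σ y)

theorem evidence_eq_ofReal [IsProbabilityMeasure μ₀] (hF : Measurable F) (σ : ℝ) (y : Data M) :
    evidence F σ μ₀ y = ENNReal.ofReal (∫ θ, likelihood F σ y θ ∂μ₀) :=
  (ofReal_integral_eq_lintegral_ofReal (integrable_likelihood hF σ y)
    (.of_forall fun θ => (likelihood_pos F σ y θ).le)).symm

theorem evidence_pos [IsProbabilityMeasure μ₀] (hF : Measurable F) (σ : ℝ) (y : Data M) :
    0 < evidence F σ μ₀ y := by
  rw [evidence_eq_ofReal hF]
  exact ENNReal.ofReal_pos.2 (integral_likelihood_pos hF σ y)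

theorem evidence_lt_top [IsProbabilityMeasure μ₀] (hF : Measurable F) (σ : ℝ) (y : Data M) :
    evidence F σ μ₀ y < ⊤ := by
  rw [evidence_eq_ofReal hF]
  exact ENNReal.ofReal_lt_top

theorem measurable_evidence [SFinite μ₀] (hF : Measurable F) (σ : ℝ) :
    Measurable (evidence F σ μ₀) :=
  (measurable_likelihood hF σ).ennreal_ofReal.lintegral_prod_right'

theorem bayesMeasure_eq_withDensity [IsProbabilityMeasure μ₀] (hF : Measurable F) (σ : ℝ)
    (y : Data M) : bayesMeasure F σ μ₀ y = μ₀.withDensity fun θ =>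
      (evidence F σ μ₀ y)⁻¹ * ENNReal.ofReal (likelihood F σ y θ) := by
  rw [bayesMeasure, ← withDensity_smul _ (measurable_likelihood_right hF σ y).ennreal_ofReal]
  rfl

theorem isProbabilityMeasure_bayesMeasure [IsProbabilityMeasure μ₀] (hF : Measurable F) (σ : ℝ)
    (y : Data M) : IsProbabilityMeasure (bayesMeasure F σ μ₀ y) := by
  refine ⟨?_⟩
  rw [bayesMeasure, Measure.smul_apply, withDensity_apply _ MeasurableSet.univ,
    Measure.restrict_univ, smul_eq_mul]
  exact ENNReal.inv_mul_cancel (evidence_pos hF σ y).ne' (evidence_lt_top hF σ y).ne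

/-- The posterior as a kernel. -/
def posteriorKernel (F : Param → Data M) (σ : ℝ) (μ₀ : Measure Param) [SFinite μ₀] :
    Kernel (Data M) Param :=
  Kernel.withDensity (Kernel.const _ μ₀) fun y θ =>
    (evidence F σ μ₀ y)⁻¹ * ENNReal.ofReal (likelihood F σ y θ)

theorem posteriorKernel_apply [IsProbabilityMeasure μ₀] (hF : Measurable F) (σ : ℝ)
    (y : Data M) : posteriorKernel F σ μ₀ y = bayesMeasure F σ μ₀ y := by
  rw [posteriorKernel, Kernel.withDensity_apply, bayesMeasure_eq_withDensity hF, Kernel.const_apply]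
  exact ((measurable_evidence hF σ).comp measurable_fst).inv.mul
    (measurable_likelihood hF σ).ennreal_ofReal

theorem isMarkovKernel_posteriorKernel [IsProbabilityMeasure μ₀] (hF : Measurable F) (σ : ℝ) :
    IsMarkovKernel (posteriorKernel F σ μ₀) := by
  refine ⟨fun y => ?_⟩
  rw [posteriorKernel_apply hF]
  exact isProbabilityMeasure_bayesMeasure hF σ y

/-- The joint law of data and parameter, tested against a nonnegative function. -/
theorem lintegral_data_param {S : Type*} [MeasurableSpace S] {P : Measure S}
    [IsProbabilityMeasure P] [IsProbabilityMeasure μ₀] (hF : Measurable F) (hσ : 0 < σ)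
    {θ : S → Param} {ε : S → Data M} (hθ : Measurable θ) (hε : Measurable ε)
    (hθl : P.map θ = μ₀)
    (hεl : P.map ε = multivariateGaussian 0 (σ ^ 2 • (1 : Matrix (Fin M) (Fin M) ℝ)))
    (hind : IndepFun θ ε P) {h : Data M × Param → ℝ≥0∞} (hh : Measurable h) :
    ∫⁻ s, h (F (θ s) + ε s, θ s) ∂P = ∫⁻ y, ∫⁻ t, h (y, t) *
      (ENNReal.ofReal ((∫ x : Data M, Real.exp (-(1 / 2) * ‖σ⁻¹ • x‖ ^ 2))⁻¹) *
        ENNReal.ofReal (likelihood F σ y t)) ∂μ₀ := by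
  set c := ENNReal.ofReal ((∫ x : Data M, Real.exp (-(1 / 2) * ‖σ⁻¹ • x‖ ^ 2))⁻¹)
  have hjoint : P.map (fun s => (θ s, ε s)) = μ₀.prod (P.map ε) := by
    rw [(indepFun_iff_map_prod_eq_prod_map_map hθ.aemeasurable hε.aemeasurable).1 hind, hθl]
  have : IsProbabilityMeasure (P.map ε) := Measure.isProbabilityMeasure_map hε.aemeasurable
  have hm : Measurable fun p : Param × Data M => h (F p.1 + p.2, p.1) :=
    hh.comp (((hF.comp measurable_fst).add measurable_snd).prodMk measurable_fst)
  have hl := (measurable_likelihood hF σ).ennreal_ofReal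
  calc ∫⁻ s, h (F (θ s) + ε s, θ s) ∂P
      = ∫⁻ p, h (F p.1 + p.2, p.1) ∂(P.map fun s => (θ s, ε s)) :=
        (lintegral_map hm (hθ.prodMk hε)).symm
    _ = ∫⁻ t, ∫⁻ e, h (F t + e, t) ∂(P.map ε) ∂μ₀ := by
        rw [hjoint, lintegral_prod _ hm.aemeasurable]
    -- For fixed `t` the substitution `y = F t + e` uses translation invariance of Lebesgue measure
    -- and turns the noise density into the likelihood.
    _ = ∫⁻ t, (∫⁻ y, h (y, t) * (c * ENNReal.ofReal (likelihood F σ y t))) ∂μ₀ := by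
        refine lintegral_congr fun t => ?_
        have hm' : Measurable fun e => h (F t + e, t) := hm.comp measurable_prodMk_left
        rw [hεl, multivariateGaussian_eq_withDensity hσ,
          lintegral_withDensity_eq_lintegral_mul _ (by fun_prop) hm',
          ← lintegral_add_left_eq_self (fun y => h (y, t) *
            (c * ENNReal.ofReal (likelihood F σ y t))) (F t)]
        refine lintegral_congr fun e => ?_
        simp only [Pi.mul_apply, likelihood, add_sub_cancel_left]
        exact mul_comm _ _
    _ = _ := by
        refine lintegral_lintegral_swap ?_
        exact ((hh.comp measurable_swap).mul ((hl.comp measurable_swap).const_mul c)).aemeasurable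

/-- `lintegral_data_param` is used twice: for the indicator of `s`, and for the posterior mass of
the section of `s`, which depends on `y` only. In the second case integrating the likelihood gives
the evidence, which cancels the normalization. -/
theorem isConditionalLaw_posteriorKernel {S : Type*} [MeasurableSpace S] {P : Measure S}
    [IsProbabilityMeasure P] [IsProbabilityMeasure μ₀] (hF : Measurable F) (hσ : 0 < σ)
    {θ : S → Param} {ε : S → Data M} (hθ : Measurable θ) (hε : Measurable ε)
    (hθl : P.map θ = μ₀)
    (hεl : P.map ε = multivariateGaussian 0 (σ ^ 2 • (1 : Matrix (Fin M) (Fin M) ℝ)))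
    (hind : IndepFun θ ε P) :
    IsConditionalLaw P θ (fun s => F (θ s) + ε s) (posteriorKernel F σ μ₀) := by
  have := isMarkovKernel_posteriorKernel (μ₀ := μ₀) hF σ
  have hd : Measurable fun s => F (θ s) + ε s := (hF.comp hθ).add hε
  have : IsProbabilityMeasure (P.map fun s => F (θ s) + ε s) :=
    Measure.isProbabilityMeasure_map hd.aemeasurable
  have key := @lintegral_data_param M F σ μ₀ S _ P _ _ hF hσ θ ε hθ hε hθl hεl hind
  set c := ENNReal.ofReal ((∫ x : Data M, Real.exp (-(1 / 2) * ‖σ⁻¹ • x‖ ^ 2))⁻¹)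
  have hl := fun y => (measurable_likelihood_right hF σ y).ennreal_ofReal
  refine Measure.ext fun s hs => ?_
  have hk := Kernel.measurable_kernel_prodMk_left (κ := posteriorKernel F σ μ₀) hs
  have hi : Measurable (s.indicator fun _ => (1 : ℝ≥0∞)) := measurable_const.indicator hs
  rw [Measure.map_apply (hd.prodMk hθ) hs, Measure.compProd_apply hs, lintegral_map hk hd,
    key (h := fun p => posteriorKernel F σ μ₀ p.1 (Prod.mk p.1 ⁻¹' s)) (hk.comp measurable_fst),
    ← lintegral_indicator_one (hd.prodMk hθ hs)]
  have h1 := key hi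
  refine Eq.trans (Eq.trans (lintegral_congr fun x => ?_) h1) (lintegral_congr fun y => ?_)
  · rfl
  · have hs' : MeasurableSet (Prod.mk y ⁻¹' s) := measurable_prodMk_left hs
    change _ = ∫⁻ t, posteriorKernel F σ μ₀ y (Prod.mk y ⁻¹' s) *
      (c * ENNReal.ofReal (likelihood F σ y t)) ∂μ₀
    rw [lintegral_const_mul (posteriorKernel F σ μ₀ y (Prod.mk y ⁻¹' s)) ((hl y).const_mul c),
      lintegral_const_mul c (hl y), posteriorKernel_apply hF, bayesMeasure, Measure.smul_apply,
      withDensity_apply _ hs',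
      smul_eq_mul, ← lintegral_indicator hs']
    have e : ∀ t, s.indicator (fun _ => (1 : ℝ≥0∞)) (y, t) *
        (c * ENNReal.ofReal (likelihood F σ y t)) = c *
        (Prod.mk y ⁻¹' s).indicator (fun t => ENNReal.ofReal (likelihood F σ y t)) t := by
      intro t
      by_cases h : (y, t) ∈ s
      · simp [h]
      · simp [h]
    simp only [e]
    rw [lintegral_const_mul _ ((hl y).indicator hs')]
    change _ = _ * (c * evidence F σ μ₀ y)
    have h0 := (evidence_pos (μ₀ := μ₀) hF σ y).ne'
    have ht := (evidence_lt_top (μ₀ := μ₀) hF σ y).ne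
    rw [mul_comm c (evidence F σ μ₀ y), mul_assoc, mul_left_comm _ (evidence F σ μ₀ y), ← mul_assoc,
      ENNReal.inv_mul_cancel h0 ht, one_mul, mul_comm]

end Bayes

/-! ### Hellinger continuity in the data -/

section Hellinger

/-- The densities with respect to the sum are `f/(f+g)` and `g/(f+g)`, and the factor `f+g` of the
sum cancels the denominators. The reference measure becomes `μ`. -/
theorem hellingerDist_withDensity {A : Type*} [MeasurableSpace A] {μ : Measure A}
    {f g : A → ℝ} (hf : Measurable f) (hg : Measurable g) (hf0 : ∀ x, 0 < f x)
    (hg0 : ∀ x, 0 < g x) [IsFiniteMeasure (μ.withDensity fun x => ENNReal.ofReal (f x))]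
    [IsFiniteMeasure (μ.withDensity fun x => ENNReal.ofReal (g x))] :
    hellingerDist (μ.withDensity fun x => ENNReal.ofReal (f x))
      (μ.withDensity fun x => ENNReal.ofReal (g x)) =
      √(1 / 2 * ∫ x, (√(f x) - √(g x)) ^ 2 ∂μ) := by
  set ν₁ := μ.withDensity fun x => ENNReal.ofReal (f x) with hν₁
  set ν₂ := μ.withDensity fun x => ENNReal.ofReal (g x) with hν₂
  have hsum : ν₁ + ν₂ = μ.withDensity fun x => ENNReal.ofReal (f x + g x) := by
    rw [hν₁, hν₂, ← withDensity_add_left hf.ennreal_ofReal]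
    congr 1
    ext x
    simp [ENNReal.ofReal_add (hf0 x).le (hg0 x).le]
  have hm : Measurable fun x => ENNReal.ofReal (f x + g x) := (hf.add hg).ennreal_ofReal
  have hq : ∀ k : A → ℝ, Measurable k → Measurable fun x => ENNReal.ofReal (k x / (f x + g x)) :=
    fun k hk => (hk.div (hf.add hg)).ennreal_ofReal
  have hdens : ∀ k : A → ℝ, Measurable k → (∀ x, 0 < k x) →
      μ.withDensity (fun x => ENNReal.ofReal (k x)) =
      (ν₁ + ν₂).withDensity fun x => ENNReal.ofReal (k x / (f x + g x)) := by
    intro k hk hk0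
    rw [hsum, ← withDensity_mul _ hm (hq k hk)]
    congr 1
    ext x
    have := hf0 x
    have := hg0 x
    have := hk0 x
    rw [Pi.mul_apply, ← ENNReal.ofReal_mul (by positivity), mul_div_cancel₀ _ (by positivity)]
  have h1 : ν₁.rnDeriv (ν₁ + ν₂) =ᵐ[ν₁ + ν₂] fun x => ENNReal.ofReal (f x / (f x + g x)) := by
    have := Measure.rnDeriv_withDensity (ν₁ + ν₂) (hq f hf)
    rwa [← hdens f hf hf0] at this
  have h2 : ν₂.rnDeriv (ν₁ + ν₂) =ᵐ[ν₁ + ν₂] fun x => ENNReal.ofReal (g x / (f x + g x)) := by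
    have := Measure.rnDeriv_withDensity (ν₁ + ν₂) (hq g hg)
    rwa [← hdens g hg hg0] at this
  have h3 : ∫ x, (√(ν₁.rnDeriv (ν₁ + ν₂) x).toReal - √(ν₂.rnDeriv (ν₁ + ν₂) x).toReal) ^ 2
      ∂(ν₁ + ν₂) = ∫ x, (√(f x / (f x + g x)) - √(g x / (f x + g x))) ^ 2 ∂(ν₁ + ν₂) := by
    refine integral_congr_ae ?_
    filter_upwards [h1, h2] with x e1 e2
    have := hf0 x
    have := hg0 x
    rw [e1, e2, ENNReal.toReal_ofReal (by positivity), ENNReal.toReal_ofReal (by positivity)]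
  rw [hellingerDist, h3, hsum, integral_withDensity_eq_integral_toReal_smul hm
    (.of_forall fun x => ENNReal.ofReal_lt_top)]
  congr 2
  refine integral_congr_ae (.of_forall fun x => ?_)
  have h4 := hf0 x
  have h5 := hg0 x
  have h6 : 0 < f x + g x := by positivity
  simp only
  rw [ENNReal.toReal_ofReal h6.le, Real.sqrt_div h4.le, Real.sqrt_div h5.le, ← sub_div, div_pow,
    Real.sq_sqrt h6.le, smul_eq_mul, mul_div_cancel₀ _ h6.ne']

/-- The derivative is at most `1` in absolute value, because `|r|/2 ≤ 1 + r²/4 ≤ exp(r²/4)`. -/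
theorem abs_exp_neg_sq_sub_le (s t : ℝ) :
    |Real.exp (-(1 / 4) * s ^ 2) - Real.exp (-(1 / 4) * t ^ 2)| ≤ |s - t| := by
  have hd : ∀ r : ℝ, HasDerivAt (fun r : ℝ => Real.exp (-(1 / 4) * r ^ 2))
      (Real.exp (-(1 / 4) * r ^ 2) * (-(1 / 4) * (2 * r))) r := fun r => by
    simpa using ((hasDerivAt_pow 2 r).const_mul (-(1 / 4 : ℝ))).exp
  have hl : LipschitzWith 1 fun r : ℝ => Real.exp (-(1 / 4) * r ^ 2) := by
    refine lipschitzWith_of_nnnorm_deriv_le (fun r => (hd r).differentiableAt) fun r => ?_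
    rw [(hd r).deriv, ← NNReal.coe_le_coe, coe_nnnorm, norm_mul, Real.norm_eq_abs, Real.abs_exp,
      NNReal.coe_one, neg_mul, Real.exp_neg, inv_mul_le_iff₀ (Real.exp_pos _), mul_one,
      Real.norm_eq_abs]
    have h1 := Real.add_one_le_exp (1 / 4 * r ^ 2)
    refine le_trans (abs_le.2 ⟨?_, ?_⟩) h1 <;> nlinarith [sq_nonneg (r - 1), sq_nonneg (r + 1)]
  simpa [Real.dist_eq] using hl.dist_le_mul s t

variable {M : ℕ} {F : Param → Data M} {σ : ℝ} {μ₀ : Measure Param}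

theorem sqrt_likelihood (F : Param → Data M) (σ : ℝ) (y : Data M) (θ : Param) :
    √(likelihood F σ y θ) = Real.exp (-(1 / 4) * ‖σ⁻¹ • (y - F θ)‖ ^ 2) := by
  rw [likelihood, Real.sqrt_eq_iff_mul_self_eq (Real.exp_pos _).le (Real.exp_pos _).le,
    ← Real.exp_add]
  congr 1
  ring

theorem abs_sqrt_likelihood_sub_le (hσ : 0 < σ) (y y' : Data M) (θ : Param) :
    |√(likelihood F σ y θ) - √(likelihood F σ y' θ)| ≤ σ⁻¹ * ‖y - y'‖ := by
  rw [sqrt_likelihood, sqrt_likelihood]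
  refine (abs_exp_neg_sq_sub_le _ _).trans ((abs_norm_sub_norm_le _ _).trans (le_of_eq ?_))
  rw [← smul_sub, sub_sub_sub_cancel_right, norm_smul, Real.norm_eq_abs,
    abs_of_pos (inv_pos.2 hσ)]

theorem abs_likelihood_sub_le (hσ : 0 < σ) (y y' : Data M) (θ : Param) :
    |likelihood F σ y θ - likelihood F σ y' θ| ≤ 2 * σ⁻¹ * ‖y - y'‖ := by
  have h := abs_sqrt_likelihood_sub_le (F := F) hσ y y' θ
  have h1 := Real.sqrt_le_one.2 (likelihood_le_one F σ y θ)
  have h2 := Real.sqrt_le_one.2 (likelihood_le_one F σ y' θ)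
  have e : likelihood F σ y θ - likelihood F σ y' θ =
      (√(likelihood F σ y θ) + √(likelihood F σ y' θ)) *
      (√(likelihood F σ y θ) - √(likelihood F σ y' θ)) := by
    rw [← sq_sub_sq, Real.sq_sqrt (likelihood_pos _ _ _ _).le,
      Real.sq_sqrt (likelihood_pos _ _ _ _).le]
  rw [e, abs_mul, abs_of_nonneg (by positivity), mul_assoc]
  gcongr
  linarith

/-- The Bayes measures depend locally Lipschitz continuously on the data. -/
theorem exists_hellingerDist_le [IsProbabilityMeasure μ₀] (hF : Measurable F) (hσ : 0 < σ)
    (r : ℝ) : ∃ L : ℝ, ∀ y y' : Data M, ‖y‖ ≤ r → ‖y'‖ ≤ r →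
      hellingerDist (bayesMeasure F σ μ₀ y) (bayesMeasure F σ μ₀ y') ≤ L * ‖y - y'‖ := by
  let z : Data M → ℝ := fun y => ∫ θ, likelihood F σ y θ ∂μ₀
  have hz : ∀ y, 0 < z y := integral_likelihood_pos hF σ
  -- For `‖y‖ ≤ r` the misfit is at most `σ⁻¹(r + ‖F θ‖)`. This gives a lower bound independent of
  -- `y`, positive even if `F` is unbounded.
  have hlow : ∃ m : ℝ, 0 < m ∧ ∀ y, ‖y‖ ≤ r → m ≤ z y := by
    have hInt : Integrable (fun θ => Real.exp (-(1 / 2) * (σ⁻¹ * (r + ‖F θ‖)) ^ 2)) μ₀ := by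
      refine Integrable.of_bound (by fun_prop : Measurable _).aestronglyMeasurable 1
        (.of_forall fun θ => ?_)
      rw [Real.norm_eq_abs, Real.abs_exp, Real.exp_le_one_iff]
      have := sq_nonneg (σ⁻¹ * (r + ‖F θ‖))
      linarith
    refine ⟨_, integral_exp_pos hInt, fun y hy => ?_⟩
    refine integral_mono hInt (integrable_likelihood hF σ y) fun θ => ?_
    simp only [likelihood]
    rw [Real.exp_le_exp]
    have h1 : ‖σ⁻¹ • (y - F θ)‖ ≤ σ⁻¹ * (r + ‖F θ‖) := by
      rw [norm_smul, Real.norm_eq_abs, abs_of_pos (inv_pos.2 hσ)]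
      gcongr
      exact (norm_sub_le _ _).trans (by linarith)
    have h2 : ‖σ⁻¹ • (y - F θ)‖ ^ 2 ≤ (σ⁻¹ * (r + ‖F θ‖)) ^ 2 := by gcongr
    linarith
  obtain ⟨m, hm, hmz⟩ := hlow
  have hzlip : ∀ y y', |z y - z y'| ≤ 2 * σ⁻¹ * ‖y - y'‖ := by
    intro y y'
    simp only [z]
    rw [← integral_sub (integrable_likelihood hF σ y) (integrable_likelihood hF σ y'),
      ← Real.norm_eq_abs]
    have := norm_integral_le_of_norm_le_const (μ := μ₀) (C := 2 * σ⁻¹ * ‖y - y'‖)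
      (f := fun θ => likelihood F σ y θ - likelihood F σ y' θ)
      (.of_forall fun θ => abs_likelihood_sub_le (F := F) hσ y y' θ)
    simpa using this
  have hBayes : ∀ y, bayesMeasure F σ μ₀ y = μ₀.withDensity fun θ =>
      ENNReal.ofReal ((z y)⁻¹ * likelihood F σ y θ) := by
    intro y
    rw [bayesMeasure_eq_withDensity hF, evidence_eq_ofReal hF]
    congr 1
    ext θ
    rw [ENNReal.ofReal_mul (inv_pos.2 (hz y)).le, ENNReal.ofReal_inv_of_pos (hz y)]
  -- The first term comes from the change of the root likelihood, the second from that of `1/√z`,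
  -- through `1/√z - 1/√z' = (z' - z)/((√z + √z')√z√z')`.
  set Λ := (√m)⁻¹ * σ⁻¹ + (2 * √m * m)⁻¹ * (2 * σ⁻¹) with hΛ
  have hΛ0 : 0 ≤ Λ := by positivity
  refine ⟨Λ, fun y y' hy hy' => ?_⟩
  have hmeas : ∀ y, Measurable fun θ => (z y)⁻¹ * likelihood F σ y θ := fun y =>
    (measurable_likelihood_right hF σ y).const_mul _
  have hpos : ∀ y θ, 0 < (z y)⁻¹ * likelihood F σ y θ := fun y θ =>
    mul_pos (inv_pos.2 (hz y)) (likelihood_pos _ _ _ _)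
  have hfin : ∀ y, IsFiniteMeasure (μ₀.withDensity fun θ =>
      ENNReal.ofReal ((z y)⁻¹ * likelihood F σ y θ)) := fun y => by
    rw [← hBayes]
    have := isProbabilityMeasure_bayesMeasure (μ₀ := μ₀) hF σ y
    infer_instance
  have := hfin y
  have := hfin y'
  rw [hBayes, hBayes, hellingerDist_withDensity (hmeas y) (hmeas y') (hpos y) (hpos y')]
  have hpt : ∀ θ, |√((z y)⁻¹ * likelihood F σ y θ) - √((z y')⁻¹ * likelihood F σ y' θ)| ≤
      Λ * ‖y - y'‖ := by
    intro θ
    have h1 := hmz y hy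
    have h2 := hmz y' hy'
    have s1 : √m ≤ √(z y) := Real.sqrt_le_sqrt h1
    have s2 : √m ≤ √(z y') := Real.sqrt_le_sqrt h2
    have sm : 0 < √m := Real.sqrt_pos.2 hm
    have p1 : 0 < √(z y) := Real.sqrt_pos.2 (hz y)
    have p2 : 0 < √(z y') := Real.sqrt_pos.2 (hz y')
    rw [Real.sqrt_mul (inv_pos.2 (hz y)).le, Real.sqrt_mul (inv_pos.2 (hz y')).le,
      Real.sqrt_inv, Real.sqrt_inv]
    set e := √(likelihood F σ y θ)
    set e' := √(likelihood F σ y' θ)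
    have he : |e - e'| ≤ σ⁻¹ * ‖y - y'‖ := abs_sqrt_likelihood_sub_le hσ y y' θ
    have he' : |e'| ≤ 1 := by
      rw [abs_of_nonneg (Real.sqrt_nonneg _)]
      exact Real.sqrt_le_one.2 (likelihood_le_one F σ y' θ)
    have hinv : |(√(z y))⁻¹ - (√(z y'))⁻¹| ≤ (2 * √m * m)⁻¹ * (2 * σ⁻¹ * ‖y - y'‖) := by
      have e1 : (√(z y))⁻¹ - (√(z y'))⁻¹ =
          ((√(z y) + √(z y')) * (√(z y) * √(z y')))⁻¹ * (z y' - z y) := by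
        rw [← Real.sq_sqrt (hz y).le, ← Real.sq_sqrt (hz y').le, Real.sqrt_sq p1.le,
          Real.sqrt_sq p2.le]
        field_simp
        ring
      have e2 : 2 * √m * m ≤ (√(z y) + √(z y')) * (√(z y) * √(z y')) := by
        have : m = √m * √m := (Real.mul_self_sqrt hm.le).symm
        calc 2 * √m * m = (√m + √m) * (√m * √m) := by rw [← this]; ring
          _ ≤ _ := by gcongr
      rw [e1, abs_mul, abs_of_pos (by positivity), abs_sub_comm]
      gcongr
      exact hzlip y y'
    have hs : |(√(z y))⁻¹| ≤ (√m)⁻¹ := by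
      rw [abs_of_pos (by positivity)]
      gcongr
    have e3 : (√(z y))⁻¹ * e - (√(z y'))⁻¹ * e' =
        (√(z y))⁻¹ * (e - e') + ((√(z y))⁻¹ - (√(z y'))⁻¹) * e' := by ring
    rw [e3]
    refine (abs_add_le _ _).trans ?_
    rw [abs_mul, abs_mul]
    calc |(√(z y))⁻¹| * |e - e'| + |(√(z y))⁻¹ - (√(z y'))⁻¹| * |e'|
        ≤ (√m)⁻¹ * (σ⁻¹ * ‖y - y'‖) + (2 * √m * m)⁻¹ * (2 * σ⁻¹ * ‖y - y'‖) * 1 := by gcongr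
      _ = Λ * ‖y - y'‖ := by rw [hΛ]; ring
  have hI : ∫ θ, (√((z y)⁻¹ * likelihood F σ y θ) - √((z y')⁻¹ * likelihood F σ y' θ)) ^ 2 ∂μ₀ ≤
      (Λ * ‖y - y'‖) ^ 2 := by
    have := norm_integral_le_of_norm_le_const (μ := μ₀) (C := (Λ * ‖y - y'‖) ^ 2)
      (f := fun θ => (√((z y)⁻¹ * likelihood F σ y θ) - √((z y')⁻¹ * likelihood F σ y' θ)) ^ 2)
      (.of_forall fun θ => by
        rw [Real.norm_eq_abs, abs_pow]
        exact pow_le_pow_left₀ (abs_nonneg _) (hpt θ) 2)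
    simpa using (le_abs_self _).trans this
  refine Real.sqrt_le_iff.2 ⟨by positivity, ?_⟩
  have := sq_nonneg (Λ * ‖y - y'‖)
  linarith

end Hellinger

end Torsion

end

theorem theorem3 (a b : ℝ) (ha : 0 < a) (hb : 0 < b) {M : ℕ} (φ : Fin M → ℝ)
    (hφ : ∀ i, 0 < φ i) (σ : ℝ) (hσ : 0 < σ)
    (μ₀ : Measure Torsion.Param) [IsProbabilityMeasure μ₀] :
    -- the observation operator is well-defined: the direct problem is uniquely solvable
    (∀ (θ : Torsion.Param) (i : Fin M), ∃! w : Torsion.L2Pair a b,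
      Torsion.IsWeakSolution a b θ (φ i) w) ∧
    -- the normalizing constant in Bayes' rule is positive and finite
    (∀ y : Torsion.Data M, 0 < Torsion.evidence (Torsion.observe a b φ) σ μ₀ y ∧
      Torsion.evidence (Torsion.observe a b φ) σ μ₀ y < ⊤) ∧
    -- the posterior exists, is given by Bayes' rule, and is the conditional law of `θ` given `d`
    (∃ post : Kernel (Torsion.Data M) Torsion.Param, IsMarkovKernel post ∧
      (∀ y, post y = Torsion.bayesMeasure (Torsion.observe a b φ) σ μ₀ y) ∧
      ∀ (S : Type*) [MeasurableSpace S] (P : Measure S) [IsProbabilityMeasure P]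
        (θ : S → Torsion.Param) (ε : S → Torsion.Data M),
        Measurable θ → Measurable ε → P.map θ = μ₀ →
        P.map ε = multivariateGaussian 0 (σ ^ 2 • (1 : Matrix (Fin M) (Fin M) ℝ)) →
        IndepFun θ ε P →
        Measurable (fun s => Torsion.observe a b φ (θ s) + ε s) ∧
        Torsion.IsConditionalLaw P θ (fun s => Torsion.observe a b φ (θ s) + ε s) post ∧
        ∀ K : Kernel (Torsion.Data M) Torsion.Param, IsMarkovKernel K →
          Torsion.IsConditionalLaw P θ (fun s => Torsion.observe a b φ (θ s) + ε s) K →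
          ∀ᵐ y ∂(P.map fun s => Torsion.observe a b φ (θ s) + ε s), K y = post y) ∧
    -- the posterior depends locally Lipschitz continuously on the data in Hellinger distance
    (∀ r : ℝ, 0 < r → ∃ L : ℝ, ∀ y y' : Torsion.Data M, ‖y‖ ≤ r → ‖y'‖ ≤ r →
      Torsion.hellingerDist (Torsion.bayesMeasure (Torsion.observe a b φ) σ μ₀ y)
        (Torsion.bayesMeasure (Torsion.observe a b φ) σ μ₀ y') ≤ L * ‖y - y'‖) := by
  have hφ' : ∀ i, 0 ≤ φ i := fun i => (hφ i).le
  have hF : Measurable (Torsion.observe a b φ) := (Torsion.continuous_observe ha hb hφ').measurable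
  refine ⟨fun θ i => Torsion.existsUnique_isWeakSolution ha hb θ (hφ' i),
    fun y => ⟨Torsion.evidence_pos hF σ y, Torsion.evidence_lt_top hF σ y⟩,
    ⟨Torsion.posteriorKernel (Torsion.observe a b φ) σ μ₀,
      Torsion.isMarkovKernel_posteriorKernel hF σ, Torsion.posteriorKernel_apply hF σ, ?_⟩,
    fun r _ => Torsion.exists_hellingerDist_le hF hσ r⟩
  intro S _ P _ θ ε hθ hε hθl hεl hind
  have hd : Measurable fun s => Torsion.observe a b φ (θ s) + ε s := (hF.comp hθ).add hε
  have hcond := Torsion.isConditionalLaw_posteriorKernel hF hσ hθ hε hθl hεl hind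
  refine ⟨hd, hcond, fun K hK hKcond => ?_⟩
  have := Torsion.isMarkovKernel_posteriorKernel (μ₀ := μ₀) hF σ
  have : IsProbabilityMeasure (P.map fun s => Torsion.observe a b φ (θ s) + ε s) :=
    Measure.isProbabilityMeasure_map hd.aemeasurable
  -- Both kernels disintegrate the same joint law over the same marginal.
  exact Kernel.ae_eq_of_compProd_eq (hKcond.symm.trans hcond)
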